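/- Let $F$ be a quadratically closed field, i.e. every polynomial of degree $2$ over $F$ has a root in $F$, and let $V$ be an $F$-vector space of finite dimension $n\geq 1$. A bilinear form $f:V\times V\to F$ is indecomposable if $V=U_1\oplus U_2$ with $f(U_1,U_2)=0=f(U_2,U_1)$ is only possible when $U_1=0$ or $U_2=0$. The asymmetry of a non-degenerate form $f$ is the unique $\sigma\in \mathrm{GL}(V)$ with $f(v,u)=f(u,\sigma v)$ for all $u,v\in V$, and a non-degenerate $f$ is split if the minimal polynomial of $\sigma$ splits over $F$. Forms $f,g$ on $V$ are equivalent if there is $x\in\mathrm{GL}(V)$ with $g(xu,xv)=f(u,v)$ for all $u,v\in V$. A form $f$ admits $A\in M_n(F)$ as Gram matrix if $A=(f(v_i,v_j))$ for some basis $v_1,\dots,v_n$ of $V$. Let $J_m(\lambda)\in M_m(F)$ be the lower triangular Jordan block, with $\lambda$ on the diagonal and $1$ on the subdiagonal. Let $\Gamma_n\in M_n(F)$ have entry $(-1)^{n-i}$ in the positions $(i,j)$ with $i+j\in\{n+1,n+2\}$ and $0$ elsewhere. For odd $n$ let $\Gamma_n^0\in M_n(F)$ have entry $1$ in the positions $(i,j)$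 with $i+j=n+1$, or with $i+j=n+2$ and $i>j$, and $0$ elsewhere. Consider the following list of matrices, each with a list of polynomials. - $A_n=\Gamma_n$, $n$ odd, $\mathrm{char}(F)\neq 2$: $(X-1)^n$. - $B_n=\Gamma_n^0$, $n$ odd, $\mathrm{char}(F)=2$: $(X-1)^n$. - $C_n=\Gamma_n$, $n$ even, $\mathrm{char}(F)\neq 2$: $(X+1)^n$. - $D_n=\begin{pmatrix}0&J_m(1)\\ I_m&0\end{pmatrix}$, $n=2m$, $m$ even: $(X-1)^m,(X-1)^m$. - $E_n=\begin{pmatrix}0&J_m(1)\\ I_m&0\end{pmatrix}$, $n=2m$, $m$ odd, $\mathrm{char}(F)=2$: $(X-1)^m,(X-1)^m$. - $F_n=\begin{pmatrix}0&J_m(-1)\\ I_m&0\end{pmatrix}$, $n=2m$, $m$ odd, $\mathrm{char}(F)\neq 2$: $(X+1)^m,(X+1)^m$. - $G_n(\lambda)=\begin{pmatrix}0&J_m(\lambda)\\ I_m&0\end{pmatrix}$, $n=2m$, $\lambda\in F$, $\lambda\neq 0$, $\lambda^2\neq 1$: $(X-\lambda)^m,(X-\lambda^{-1})^m$. Then: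 1. Two non-degenerate, indecomposable, split forms on $V$ are equivalent if and only if their asymmetries are similar. 2. If a bilinear form $f$ on $V$ admits a matrix of the list as Gram matrix, then $f$ is non-degenerate, indecomposable and split, and the elementary divisors of its asymmetry are the polynomials indicated. 3. Every non-degenerate, indecomposable, split form on $V$ admits one and only one matrix of the list as Gram matrix, except only that $G_n(\lambda)$ and $G_n(\lambda^{-1})$ represent equivalent forms. -/

import Mathlib

open Polynomial

namespace SplitForm

/-- `F` is quadratically closed: every quadratic polynomial over `F` has a root in `F`
(in every characteristic), i.e. `F` has no field extension of degree two. -/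
def QuadraticallyClosed (F : Type*) [Field F] : Prop :=
  ∀ b c : F, ∃ x : F, x ^ 2 + b * x + c = 0

section Forms

variable {F V : Type*} [Field F] [AddCommGroup V] [Module F V]

/-- `f` is indecomposable: `V` has no orthogonal decomposition `V = U₁ ⊥ U₂`
(with `f(U₁, U₂) = 0 = f(U₂, U₁)`) except when `U₁ = 0` or `U₂ = 0`. -/
def Indecomposable (f : LinearMap.BilinForm F V) : Prop :=
  ∀ U₁ U₂ : Submodule F V, IsCompl U₁ U₂ →
    (∀ x ∈ U₁, ∀ y ∈ U₂, f x y = 0 ∧ f y x = 0) → U₁ = ⊥ ∨ U₂ = ⊥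

/-- The asymmetry of a non-degenerate form `f`: the unique `σ ∈ GL(V)` with
`f(v, u) = f(u, σ v)` for all `u, v` (see `apply_asymmetry` and `eq_asymmetry`). -/
noncomputable def asymmetry [FiniteDimensional F V] (f : LinearMap.BilinForm F V)
    (hf : f.Nondegenerate) : V ≃ₗ[F] V :=
  (f.toDual hf).trans (f.flip.toDual hf.flip).symm

theorem apply_asymmetry [FiniteDimensional F V] (f : LinearMap.BilinForm F V)
    (hf : f.Nondegenerate) (u v : V) : f u (asymmetry f hf v) = f v u :=
  LinearMap.BilinForm.apply_toDual_symm_apply (B := f.flip) (hB := hf.flip) (f.toDual hf v) u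

theorem eq_asymmetry [FiniteDimensional F V] (f : LinearMap.BilinForm F V)
    (hf : f.Nondegenerate) (τ : V → V) (hτ : ∀ u v, f v u = f u (τ v)) :
    τ = asymmetry f hf := by
  funext v
  refine sub_eq_zero.mp (hf.2 _ fun u => ?_)
  rw [map_sub, apply_asymmetry, ← hτ, sub_self]

/-- A non-degenerate form is split if the minimal polynomial of its asymmetry splits over the
ground field. -/
def Split [FiniteDimensional F V] (f : LinearMap.BilinForm F V) (hf : f.Nondegenerate) : Prop :=
  (minpoly F (asymmetry f hf : Module.End F V)).Splits

/-- `q₁, …, q_k` is the list of elementary divisors of the endomorphism `σ`: each `qᵢ` is a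
positive power of a monic irreducible polynomial, and `V`, viewed as an `F[X]`-module with `X`
acting as `σ`, is isomorphic to `F[X]/(q₁) ⊕ ⋯ ⊕ F[X]/(q_k)`. -/
def HasElementaryDivisors (σ : Module.End F V) (q : List F[X]) : Prop :=
  (∀ r ∈ q, ∃ (p : F[X]) (k : ℕ), p.Monic ∧ Irreducible p ∧ 0 < k ∧ r = p ^ k) ∧
    Nonempty (Module.AEval' σ ≃ₗ[F[X]] ((i : Fin q.length) → F[X] ⧸ Ideal.span {q.get i}))

end Forms

section Matrices

variable (F : Type*) [Field F]

/-- The lower triangular Jordan block `J_m(c)`. -/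
def jordanBlock (m : ℕ) (c : F) : Matrix (Fin m) (Fin m) F :=
  Matrix.of fun i j => if i = j then c else if (i : ℕ) = j + 1 then 1 else 0

/-- The matrix `Γ_n`: with indices running from `1` to `n`, the entry in position `(i, j)` is
`(-1)^(n-i)` if `i + j = n + 1` or `i + j = n + 2`, and `0` otherwise. (Here indices start
at `0`, so row `i` below is row `i + 1`.) -/
def Gamma (n : ℕ) : Matrix (Fin n) (Fin n) F :=
  Matrix.of fun i j =>
    if (i : ℕ) + j + 1 = n ∨ (i : ℕ) + j = n then (-1) ^ (n - (i + 1)) else 0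

/-- The matrix `Γ_n⁰`, `n` odd: with indices running from `1` to `n`, the entry in position
`(i, j)` is `1` if `i + j = n + 1`, or if `i + j = n + 2` and `i > j`, and `0` otherwise. (Here
indices start at `0`.) -/
def GammaZero (n : ℕ) : Matrix (Fin n) (Fin n) F :=
  Matrix.of fun i j =>
    if (i : ℕ) + j + 1 = n ∨ ((i : ℕ) + j = n ∧ j < i) then 1 else 0

/-- The block matrix with rows `(0, J_m(c))` and `(I_m, 0)`, of size `2m`. -/
def blockMatrix (m : ℕ) (c : F) : Matrix (Fin (m + m)) (Fin (m + m)) F :=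
  Matrix.reindex finSumFinEquiv finSumFinEquiv (Matrix.fromBlocks 0 (jordanBlock F m c) 1 0)

/-- Labels for the entries of the list of normal forms. The families with a `2 × 2` block shape
are labelled by half of their size: `typeD m` stands for `D_{2m}`, and so on. -/
inductive NormalForm : Type _
  | typeA (n : ℕ)
  | typeB (n : ℕ)
  | typeC (n : ℕ)
  | typeD (m : ℕ)
  | typeE (m : ℕ)
  | typeF (m : ℕ)
  | typeG (m : ℕ) (c : F)

end Matrices

namespace NormalForm

variable {F : Type*} [Field F]

/-- The size of the matrix. -/
def size : NormalForm F → ℕ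
  | typeA n => n
  | typeB n => n
  | typeC n => n
  | typeD m => m + m
  | typeE m => m + m
  | typeF m => m + m
  | typeG m _ => m + m

/-- The matrix itself. -/
def matrix : (t : NormalForm F) → Matrix (Fin t.size) (Fin t.size) F
  | typeA n => Gamma F n
  | typeB n => GammaZero F n
  | typeC n => Gamma F n
  | typeD m => blockMatrix F m 1
  | typeE m => blockMatrix F m 1
  | typeF m => blockMatrix F m (-1)
  | typeG m c => blockMatrix F m c

/-- The conditions on the parameters and on the characteristic of `F` under which the matrix
belongs to the list. -/
def Admissible : NormalForm F → Prop
  | typeA n => Odd n ∧ ringChar F ≠ 2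
  | typeB n => Odd n ∧ ringChar F = 2
  | typeC n => 0 < n ∧ Even n ∧ ringChar F ≠ 2
  | typeD m => 0 < m ∧ Even m
  | typeE m => Odd m ∧ ringChar F = 2
  | typeF m => Odd m ∧ ringChar F ≠ 2
  | typeG m c => 0 < m ∧ c ≠ 0 ∧ c ^ 2 ≠ 1

/-- The elementary divisors indicated in the list. -/
noncomputable def elementaryDivisors : NormalForm F → List F[X]
  | typeA n => [(X - 1) ^ n]
  | typeB n => [(X - 1) ^ n]
  | typeC n => [(X + 1) ^ n]
  | typeD m => [(X - 1) ^ m, (X - 1) ^ m]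
  | typeE m => [(X - 1) ^ m, (X - 1) ^ m]
  | typeF m => [(X + 1) ^ m, (X + 1) ^ m]
  | typeG m c => [(X - C c) ^ m, (X - C c⁻¹) ^ m]

end NormalForm

/-- `f` admits the matrix of `t` as its Gram matrix with respect to some basis of `V`. -/
def AdmitsGram {F V : Type*} [Field F] [AddCommGroup V] [Module F V]
    (f : LinearMap.BilinForm F V) (t : NormalForm F) : Prop :=
  ∃ b : Module.Basis (Fin t.size) F V, LinearMap.BilinForm.toMatrix b f = t.matrix

end SplitForm

/-! ### Quadratic equations and two uniqueness principles for Gram matrices. -/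

namespace SplitForm

open Module

/-! Write `N_c = σ - c`. The asymmetry is an isometry, and expanding `f (σ u) (σ v) = f u v` shows
that `N_{c⁻¹}` is adjoint to `-c⁻² N_c` up to a term with one more factor `N_c`
(`IsAsymmetry.shift_adjoint`). If `N_c ^ m v = 0`, the pairings of `N_{c⁻¹} ^ a u` with `N_c ^ b v`
therefore vanish for `a + b ≥ m`, and for `a + b = m - 1` they are nonzero multiples of the top
pairing `f u (N_c ^ (m - 1) v)`. A single nonzero top pairing thus makes a whole Gram matrix
antitriangular and invertible. Since an indecomposable form has no proper nonzero non-degenerate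
`σ`-stable subspace (`Indecomposable.eq_bot_or_eq_top`), generators with such a pairing already
generate `V`.

For an eigenvalue `c`, Fitting's lemma applied to `(σ - c) (σ - c⁻¹)` leaves only the eigenvalues
`c` and `c⁻¹`. Let `m` be the nilpotency index of `N_c` on the generalized eigenspace of `c`. If `c²
≠ 1`, the two eigenspaces are totally isotropic and in duality, and a nonzero top pairing gives a
hyperbolic pair. If `c² = 1`, the top pairing `f x (N_c ^ (m - 1) y)` is symmetric or skew with sign
`c (-1) ^ (m - 1)`. When it is not alternating, one cyclic vector generates `V`; when it is
alternating, the sign is `-1` and a hyperbolic pair generates `V`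
(`Indecomposable.exists_generators`).

Quadratic closure normalizes the generators. The values `f (N ^ i u) (N ^ j u)` are determined by
those with `i = j`, and the latter can be prescribed from the top exponent downwards, each by
solving one quadratic equation (`IsAsymmetry.exists_adjust`). This makes hyperbolic pairs isotropic,
and makes cyclic forms with equal parameters equivalent.

Conversely, every matrix of the list comes with such generators. In an orthogonal decomposition one
summand inherits a nonzero top pairing, hence generators of the same size, hence is everything. The
eigenvalue, the dimension, the characteristic and, for `C` against `F`, the nilpotency index
separate the normal forms up to inverting the parameter of `G`; so similarity of asymmetries forces
equivalence. -/

theorem QuadraticallyClosed.exists_root {F : Type*} [Field F] (hF : QuadraticallyClosed F)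
    (a b c : F) (hb : b ≠ 0) : ∃ x : F, a + x * b + x ^ 2 * c = 0 := by
  by_cases hc : c = 0
  · refine ⟨-a / b, ?_⟩
    rw [hc]
    field_simp
    ring
  · obtain ⟨x, hx⟩ := hF (b / c) (a / c)
    refine ⟨x, ?_⟩
    have : c * (x ^ 2 + b / c * x + a / c) = 0 := by rw [hx, mul_zero]
    rw [← this]
    field_simp
    ring

theorem QuadraticallyClosed.exists_sq {F : Type*} [Field F] (hF : QuadraticallyClosed F)
    (a : F) : ∃ x : F, x ^ 2 = a := by
  obtain ⟨x, hx⟩ := hF 0 (-a)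
  exact ⟨x, by linear_combination hx⟩

/-- A matrix which vanishes below the antidiagonal and has no zero on the antidiagonal is
injective. -/
theorem eq_zero_of_antitriangular {F : Type*} [Field F] {m : ℕ} {B : ℕ → ℕ → F}
    (h₀ : ∀ k i, m ≤ k + i → B k i = 0) (h₁ : ∀ k i, k + i + 1 = m → B k i ≠ 0)
    {a : Fin m → F} (ha : ∀ k < m, ∑ i : Fin m, B k i * a i = 0) : a = 0 := by
  suffices h : ∀ n (hn : n < m), a ⟨n, hn⟩ = 0 from funext fun i => h i i.2
  intro n
  induction n using Nat.strong_induction_on with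
  | _ n ih =>
    intro hn
    have hk := ha (m - 1 - n) (by omega)
    rw [Finset.sum_eq_single ⟨n, hn⟩] at hk
    · exact (mul_eq_zero.mp hk).resolve_left (h₁ _ _ (by simp only; omega))
    · rintro ⟨i, hi⟩ - hne
      rcases lt_or_gt_of_ne (fun h => hne (Fin.ext h) : i ≠ n) with h | h
      · rw [ih i h hi, mul_zero]
      · rw [h₀ _ _ (by simp only; omega), zero_mul]
    · exact fun h => absurd (Finset.mem_univ _) h

/-- A function of two indices satisfying the recurrence of `(i, j) ↦ f (N ^ i u) (N ^ j u)`,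
with `σ = N + c` the asymmetry of `f`, is determined by its diagonal. -/
theorem eq_zero_of_diagonal {F : Type*} [Field F] {c : F} (hc : c ≠ 0) {B : ℕ → ℕ → F}
    (hB : ∀ i j, B i (j + 1) = B j i - c * B i j) (hd : ∀ i, B i i = 0) (i j : ℕ) :
    B i j = 0 := by
  have key : ∀ d i, B i (i + d) = 0 ∧ B (i + d) i = 0 := by
    intro d
    induction d with
    | zero => exact fun i => ⟨hd i, hd i⟩
    | succ d ih =>
      intro i
      have h1 : B i (i + (d + 1)) = 0 := by
        rw [← add_assoc, hB, (ih i).1, (ih i).2, mul_zero, sub_zero]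
      refine ⟨h1, ?_⟩
      have h2 := hB (i + (d + 1)) i
      have h3 := (ih (i + 1)).2
      rw [show i + 1 + d = i + (d + 1) by ring] at h3
      rw [h1, h3, zero_sub, eq_comm, neg_eq_zero] at h2
      exact (mul_eq_zero.mp h2).resolve_left hc
  rcases le_total i j with h | h
  · obtain ⟨d, rfl⟩ := Nat.exists_eq_add_of_le h
    exact (key d i).1
  · obtain ⟨d, rfl⟩ := Nat.exists_eq_add_of_le h
    exact (key d j).2

/-! ### The asymmetry and the adjointness of its shifts. -/

section Asymmetry

variable {F V : Type*} [Field F] [AddCommGroup V] [Module F V]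

/-- `σ` satisfies the defining identity of the asymmetry of `f`. -/
def IsAsymmetry (f : LinearMap.BilinForm F V) (σ : End F V) : Prop :=
  ∀ u v, f u (σ v) = f v u

theorem isAsymmetry_asymmetry [FiniteDimensional F V] (f : LinearMap.BilinForm F V)
    (hf : f.Nondegenerate) : IsAsymmetry f (asymmetry f hf : End F V) :=
  apply_asymmetry f hf

/-- The endomorphism `σ - c`. -/
def shift (σ : End F V) (c : F) : End F V := σ - c • 1

theorem shift_apply (σ : End F V) (c : F) (v : V) : shift σ c v = σ v - c • v := rfl

theorem apply_eq_shift_add (σ : End F V) (c : F) (v : V) : σ v = shift σ c v + c • v := by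
  rw [shift_apply, sub_add_cancel]

theorem commute_shift (σ : End F V) (c : F) : Commute σ (shift σ c) :=
  (Commute.refl σ).sub_right ((Commute.one_right σ).smul_right c)

theorem commute_shift_shift (σ : End F V) (c d : F) : Commute (shift σ c) (shift σ d) :=
  (commute_shift σ d).sub_left ((Commute.one_left _).smul_left c)

theorem pow_shift_comm (σ : End F V) (c : F) (k : ℕ) (v : V) :
    (σ ^ k) (shift σ c v) = shift σ c ((σ ^ k) v) :=
  LinearMap.congr_fun ((commute_shift σ c).pow_left k).eq v

theorem pow_add_apply (N : End F V) (a b : ℕ) (v : V) : (N ^ a) ((N ^ b) v) = (N ^ (a + b)) v := by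
  rw [pow_add, Module.End.mul_apply]

theorem pow_succ_apply (N : End F V) (a : ℕ) (v : V) : (N ^ (a + 1)) v = N ((N ^ a) v) := by
  rw [pow_succ', Module.End.mul_apply]

theorem pow_succ_apply' (N : End F V) (a : ℕ) (v : V) : (N ^ (a + 1)) v = (N ^ a) (N v) := by
  rw [pow_succ, Module.End.mul_apply]

theorem pow_apply_eq_zero_of_le {N : End F V} {m k : ℕ} {v : V} (h : (N ^ m) v = 0)
    (hk : m ≤ k) : (N ^ k) v = 0 := by
  obtain ⟨d, rfl⟩ := Nat.exists_eq_add_of_le' hk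
  rw [← pow_add_apply, h, map_zero]

variable {f : LinearMap.BilinForm F V} {σ : End F V}

namespace IsAsymmetry

theorem isometry (hσ : IsAsymmetry f σ) (u v : V) : f (σ u) (σ v) = f u v := by
  rw [hσ, hσ]

theorem apply_shift (hσ : IsAsymmetry f σ) (c : F) (u v : V) :
    f u (shift σ c v) = f v u - c * f u v := by
  rw [shift_apply, map_sub, hσ, map_smul, smul_eq_mul]

/-- Substitute `σ = N_{c⁻¹} + c⁻¹` on the left and `σ = N_c + c` on the right in the isometry
identity; the constant terms cancel because `c⁻¹ c = 1`. The last term has higher total degree, so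
it disappears in top degree. -/
theorem shift_adjoint (hσ : IsAsymmetry f σ) {c : F} (hc : c ≠ 0) (u v : V) :
    f (shift σ c⁻¹ u) v = -c⁻¹ ^ 2 * f u (shift σ c v)
      - c⁻¹ * f (shift σ c⁻¹ u) (shift σ c v) := by
  have h := hσ.isometry u v
  rw [apply_eq_shift_add σ c⁻¹ u, apply_eq_shift_add σ c v] at h
  simp only [map_add, LinearMap.add_apply, map_smul, LinearMap.smul_apply, smul_eq_mul] at h
  field_simp at h ⊢
  linear_combination h

theorem apply_pow_eq_zero (hσ : IsAsymmetry f σ) {c : F} (hc : c ≠ 0) {m : ℕ} {v : V}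
    (hv : (shift σ c ^ m) v = 0) (u : V) {a b : ℕ} (hab : m ≤ a + b) :
    f ((shift σ c⁻¹ ^ a) u) ((shift σ c ^ b) v) = 0 := by
  induction a generalizing b with
  | zero => rw [pow_apply_eq_zero_of_le hv (by omega), map_zero]
  | succ a ih =>
    -- Moving one factor across gives a term of the same total degree with smaller `a`, and a term
    -- with the same `a` and larger `b`; the second kind ends once `b ≥ m`.
    induction h : m - b generalizing b with
    | zero => rw [pow_apply_eq_zero_of_le hv (by omega), map_zero]
    | succ d ih' =>
      rw [pow_succ_apply, hσ.shift_adjoint hc, ← pow_succ_apply, ← pow_succ_apply,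
        ih (by omega), ih' (by omega) (by omega), mul_zero, mul_zero, sub_zero]

theorem apply_pow_eq (hσ : IsAsymmetry f σ) {c : F} (hc : c ≠ 0) {m : ℕ} {v : V}
    (hv : (shift σ c ^ m) v = 0) (u : V) {a b : ℕ} (hab : a + b + 1 = m) :
    f ((shift σ c⁻¹ ^ a) u) ((shift σ c ^ b) v) =
      (-c⁻¹ ^ 2) ^ a * f u ((shift σ c ^ (m - 1)) v) := by
  induction a generalizing b with
  | zero =>
    rw [pow_zero, pow_zero, one_mul, Module.End.one_apply]
    congr 4
    omega
  | succ a ih =>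
    rw [pow_succ_apply, hσ.shift_adjoint hc, ← pow_succ_apply, ← pow_succ_apply,
      ih (by omega), hσ.apply_pow_eq_zero hc hv u (by omega), mul_zero, sub_zero, ← mul_assoc,
      ← pow_succ']

theorem apply_pow_ne_zero (hσ : IsAsymmetry f σ) {c : F} (hc : c ≠ 0) {m : ℕ} {v : V}
    (hv : (shift σ c ^ m) v = 0) {u : V} (h : f u ((shift σ c ^ (m - 1)) v) ≠ 0)
    {a b : ℕ} (hab : a + b + 1 = m) :
    f ((shift σ c⁻¹ ^ a) u) ((shift σ c ^ b) v) ≠ 0 := by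
  rw [hσ.apply_pow_eq hc hv u hab]
  exact mul_ne_zero (pow_ne_zero _ (neg_ne_zero.mpr (pow_ne_zero _ (inv_ne_zero hc)))) h

/-- The two pairings of generators of dual cyclic submodules. -/
theorem apply_pow_swap (hσ : IsAsymmetry f σ) {c : F} (hc : c ≠ 0) {m : ℕ} (hm : 0 < m)
    {u w : V} (hu : (shift σ c ^ m) u = 0) (hw : (shift σ c⁻¹ ^ m) w = 0) :
    f u ((shift σ c⁻¹ ^ (m - 1)) w) =
      c * (-c⁻¹ ^ 2) ^ (m - 1) * f w ((shift σ c ^ (m - 1)) u) := by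
  have h := hσ.apply_pow_eq hc hu w (a := m - 1) (b := 0) (by omega)
  rw [mul_assoc, ← h, pow_zero, Module.End.one_apply, ← hσ u,
    apply_eq_shift_add σ c⁻¹ ((shift σ c⁻¹ ^ (m - 1)) w),
    ← pow_succ_apply, Nat.sub_add_cancel hm, hw, zero_add, map_smul, smul_eq_mul,
    mul_inv_cancel_left₀ hc]

theorem isotropic_of_diagonal (hσ : IsAsymmetry f σ) {c : F} (hc : c ≠ 0) {u : V}
    (h : ∀ k, f ((shift σ c ^ k) u) ((shift σ c ^ k) u) = 0) (i j : ℕ) :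
    f ((shift σ c ^ i) u) ((shift σ c ^ j) u) = 0 := by
  refine eq_zero_of_diagonal hc (B := fun i j => f ((shift σ c ^ i) u) ((shift σ c ^ j) u))
    (fun i j => ?_) h i j
  rw [pow_succ_apply, hσ.apply_shift]

end IsAsymmetry

end Asymmetry

end SplitForm

/-! ### Stable non-degenerate subspaces. -/

namespace SplitForm

open Module

variable {F V : Type*} [Field F] [AddCommGroup V] [Module F V]
  {f : LinearMap.BilinForm F V} {σ : End F V}

theorem linearIndependent_of_gram {ι : Type*} [Fintype ι] {b : ι → V}
    (h : ∀ a : ι → F, (∀ k, f (b k) (∑ i, a i • b i) = 0) → a = 0) : LinearIndependent F b :=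
  Fintype.linearIndependent_iff.mpr fun a ha => congrFun (h a fun k => by rw [ha, map_zero])

theorem IsAsymmetry.injective (hσ : IsAsymmetry f σ) (hf : f.Nondegenerate) :
    Function.Injective σ := by
  refine (injective_iff_map_eq_zero _).mpr fun v hv => hf.1 v fun u => ?_
  rw [← hσ, hv, map_zero]

section FiniteDimensional

variable [FiniteDimensional F V]

theorem exists_mem_apply_eq {P : Submodule F V} (hinj : Function.Injective σ)
    (hP : ∀ p ∈ P, σ p ∈ P) {p : V} (hp : p ∈ P) : ∃ q ∈ P, σ q = p := by
  have h : Function.Injective (σ.restrict hP) := fun x y hxy =>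
    Subtype.ext (hinj (congrArg Subtype.val hxy))
  obtain ⟨q, hq⟩ := (LinearMap.injective_iff_surjective.mp h) ⟨p, hp⟩
  exact ⟨q, q.2, congrArg Subtype.val hq⟩

/-- An indecomposable form has no proper nonzero non-degenerate subspace which is stable under
the asymmetry. -/
theorem Indecomposable.eq_bot_or_eq_top (hind : Indecomposable f) (hσ : IsAsymmetry f σ)
    (hf : f.Nondegenerate) {P : Submodule F V} (hP : ∀ p ∈ P, σ p ∈ P)
    (hnd : ∀ p ∈ P, (∀ x ∈ P, f x p = 0) → p = 0) : P = ⊥ ∨ P = ⊤ := by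
  let φ : V →ₗ[F] Dual F P := LinearMap.compl₁₂ f.flip LinearMap.id P.subtype
  have hφ : ∀ v (x : P), φ v x = f x v := fun _ _ => rfl
  have hinj : Function.Injective (φ.domRestrict P) := by
    refine (injective_iff_map_eq_zero _).mpr fun p hp => Subtype.ext (hnd p p.2 fun x hx => ?_)
    exact LinearMap.congr_fun hp ⟨x, hx⟩
  have hsurj : Function.Surjective (φ.domRestrict P) :=
    (LinearMap.injective_iff_surjective_of_finrank_eq_finrank
      (Subspace.dual_finrank_eq (K := F) (V := P)).symm).mp hinj
  have hcompl : IsCompl P φ.ker := by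
    constructor
    · rw [Submodule.disjoint_def]
      exact fun p hp hk => hnd p hp fun x hx => LinearMap.congr_fun hk ⟨x, hx⟩
    · rw [codisjoint_iff, Submodule.eq_top_iff']
      intro v
      obtain ⟨p, hp⟩ := hsurj (φ v)
      refine Submodule.mem_sup.mpr ⟨p, p.2, v - p, ?_, add_sub_cancel _ _⟩
      rw [LinearMap.mem_ker, map_sub, ← hp, LinearMap.domRestrict_apply, sub_self]
  have horth : ∀ x ∈ P, ∀ y ∈ φ.ker, f x y = 0 := fun x hx y hy => LinearMap.congr_fun hy ⟨x, hx⟩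
  -- The kernel of `φ` is the right orthogonal of `P`. It is also left orthogonal to `P`: by finite
  -- dimension `σ` maps `P` onto `P`, and `f y (σ z) = f z y`.
  refine (hind _ _ hcompl fun x hx y hy => ⟨horth x hx y hy, ?_⟩).imp id fun h => ?_
  · obtain ⟨z, hz, rfl⟩ := exists_mem_apply_eq (hσ.injective hf) hP hx
    rw [hσ]
    exact horth z hz y hy
  · rw [h] at hcompl
    exact eq_top_of_isCompl_bot hcompl

end FiniteDimensional

/-! ### Hyperbolic pairs. -/

/-- A pair of vectors generating, under the asymmetry, two totally isotropic cyclic subspaces in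
duality, with eigenvalues `c` and `c⁻¹`. -/
structure HyperbolicPair (f : LinearMap.BilinForm F V) (σ : End F V) (c : F) (m : ℕ) (u w : V) :
    Prop where
  pow_left : (shift σ c ^ m) u = 0
  pow_right : (shift σ c⁻¹ ^ m) w = 0
  -- Diagonal values suffice: `IsAsymmetry.isotropic_of_diagonal` spreads the vanishing to the whole
  -- cyclic subspace.
  isotropic_left : ∀ k, f ((shift σ c ^ k) u) ((shift σ c ^ k) u) = 0
  isotropic_right : ∀ k, f ((shift σ c⁻¹ ^ k) w) ((shift σ c⁻¹ ^ k) w) = 0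
  pairing : f w ((shift σ c ^ (m - 1)) u) ≠ 0

namespace HyperbolicPair

variable {c : F} {m : ℕ} {u w : V}

theorem pos (h : HyperbolicPair f σ c m u w) : 0 < m := by
  rcases Nat.eq_zero_or_pos m with rfl | hm
  · refine absurd ?_ h.pairing
    have : u = 0 := h.pow_left
    rw [this, map_zero, map_zero]
  · exact hm

theorem symm (h : HyperbolicPair f σ c m u w) (hσ : IsAsymmetry f σ) (hc : c ≠ 0) :
    HyperbolicPair f σ c⁻¹ m w u where
  pow_left := h.pow_right
  pow_right := by rw [inv_inv]; exact h.pow_left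
  isotropic_left := h.isotropic_right
  isotropic_right := by rw [inv_inv]; exact h.isotropic_left
  pairing := by
    rw [hσ.apply_pow_swap hc h.pos h.pow_left h.pow_right]
    exact mul_ne_zero (mul_ne_zero hc
      (pow_ne_zero _ (neg_ne_zero.mpr (pow_ne_zero _ (inv_ne_zero hc))))) h.pairing

/-- The vectors generated by a hyperbolic pair. -/
def family (σ : End F V) (c : F) (m : ℕ) (u w : V) : Fin m ⊕ Fin m → V :=
  Sum.elim (fun i => (shift σ c ^ (i : ℕ)) u) fun i => (shift σ c⁻¹ ^ (i : ℕ)) w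

theorem gram_injective (h : HyperbolicPair f σ c m u w) (hσ : IsAsymmetry f σ) (hc : c ≠ 0)
    (a : Fin m ⊕ Fin m → F)
    (ha : ∀ k, f (family σ c m u w k) (∑ i, a i • family σ c m u w i) = 0) : a = 0 := by
  -- Pairing with the vectors from `w` eliminates their own isotropic span and leaves an
  -- antitriangular system in the coefficients of the vectors from `u`.
  have h1 : (fun i => a (Sum.inl i)) = 0 := by
    refine eq_zero_of_antitriangular
      (B := fun k i => f ((shift σ c⁻¹ ^ k) w) ((shift σ c ^ i) u))
      (fun k i hki => hσ.apply_pow_eq_zero hc h.pow_left w hki)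
      (fun k i hki => hσ.apply_pow_ne_zero hc h.pow_left h.pairing hki) fun k hk => ?_
    have := ha (Sum.inr ⟨k, hk⟩)
    simp only [family, Fintype.sum_sum_type, Sum.elim_inl, Sum.elim_inr, map_add, map_sum,
      map_smul, smul_eq_mul,
      hσ.isotropic_of_diagonal (inv_ne_zero hc) h.isotropic_right, mul_zero,
      Finset.sum_const_zero, add_zero] at this
    rw [← this]
    exact Finset.sum_congr rfl fun i _ => mul_comm _ _
  have h2 : (fun i => a (Sum.inr i)) = 0 := by
    have h' := h.symm hσ hc
    refine eq_zero_of_antitriangular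
      (B := fun k i => f ((shift σ c⁻¹⁻¹ ^ k) u) ((shift σ c⁻¹ ^ i) w))
      (fun k i hki => hσ.apply_pow_eq_zero (inv_ne_zero hc) h'.pow_left u hki)
      (fun k i hki => hσ.apply_pow_ne_zero (inv_ne_zero hc) h'.pow_left h'.pairing hki)
      fun k hk => ?_
    have := ha (Sum.inl ⟨k, hk⟩)
    simp only [family, Fintype.sum_sum_type, Sum.elim_inl, Sum.elim_inr, map_add, map_sum,
      map_smul, smul_eq_mul, hσ.isotropic_of_diagonal hc h.isotropic_left, mul_zero,
      Finset.sum_const_zero, zero_add] at this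
    rw [← this, inv_inv]
    exact Finset.sum_congr rfl fun i _ => mul_comm _ _
  funext i
  rcases i with i | i
  · exact congrFun h1 i
  · exact congrFun h2 i

theorem linearIndependent (h : HyperbolicPair f σ c m u w) (hσ : IsAsymmetry f σ) (hc : c ≠ 0) :
    LinearIndependent F (family σ c m u w) :=
  linearIndependent_of_gram (h.gram_injective hσ hc)

end HyperbolicPair

theorem apply_mem_span_pow {c : F} {m : ℕ} {u : V} (hu : (shift σ c ^ m) u = 0)
    {P : Submodule F V} (hP : ∀ i < m, (shift σ c ^ i) u ∈ P) {i : ℕ} :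
    σ ((shift σ c ^ i) u) ∈ P := by
  have h : ∀ i, (shift σ c ^ i) u ∈ P := fun i => by
    rcases lt_or_ge i m with hi | hi
    · exact hP i hi
    · rw [pow_apply_eq_zero_of_le hu hi]
      exact P.zero_mem
  rw [apply_eq_shift_add σ c, ← pow_succ_apply]
  exact P.add_mem (h _) (P.smul_mem _ (h _))

theorem mem_of_mem_span_range {ι : Type*} {b : ι → V} {P : Submodule F V} {σ : End F V}
    (h : ∀ i, σ (b i) ∈ P) {p : V} (hp : p ∈ Submodule.span F (Set.range b)) : σ p ∈ P := by
  have : Submodule.span F (Set.range b) ≤ P.comap σ := by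
    rw [Submodule.span_le]
    rintro _ ⟨i, rfl⟩
    exact h i
  exact this hp

/-- The span is `σ`-stable, nonzero, and non-degenerate by the Gram hypothesis, so indecomposability
leaves no room for a complement. -/
theorem Indecomposable.span_eq_top [FiniteDimensional F V] (hind : Indecomposable f)
    (hσ : IsAsymmetry f σ) (hf : f.Nondegenerate) {ι : Type*} [Fintype ι] [Nonempty ι] {b : ι → V}
    (hb : ∀ i, σ (b i) ∈ Submodule.span F (Set.range b))
    (h : ∀ a : ι → F, (∀ k, f (b k) (∑ i, a i • b i) = 0) → a = 0) :
    Submodule.span F (Set.range b) = ⊤ := by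
  refine (hind.eq_bot_or_eq_top hσ hf (fun p hp => mem_of_mem_span_range hb hp)
    fun p hp hx => ?_).resolve_left fun hbot => ?_
  · obtain ⟨a, rfl⟩ := (Submodule.mem_span_range_iff_exists_fun F).mp hp
    rw [h a fun k => hx _ (Submodule.subset_span ⟨k, rfl⟩)]
    simp
  · obtain ⟨i⟩ := ‹Nonempty ι›
    refine (linearIndependent_of_gram h).ne_zero i ?_
    rw [← Submodule.mem_bot F, ← hbot]
    exact Submodule.subset_span ⟨i, rfl⟩

theorem HyperbolicPair.apply_family_mem {c : F} {m : ℕ} {u w : V}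
    (h : HyperbolicPair f σ c m u w) (i : Fin m ⊕ Fin m) :
    σ (family σ c m u w i) ∈ Submodule.span F (Set.range (family σ c m u w)) := by
  rcases i with i | i
  · exact apply_mem_span_pow h.pow_left fun j hj => Submodule.subset_span
      (Set.mem_range_self (f := family σ c m u w) (Sum.inl ⟨j, hj⟩))
  · exact apply_mem_span_pow h.pow_right fun j hj => Submodule.subset_span
      (Set.mem_range_self (f := family σ c m u w) (Sum.inr ⟨j, hj⟩))

theorem HyperbolicPair.finrank_eq [FiniteDimensional F V] {c : F} {m : ℕ} {u w : V}
    (h : HyperbolicPair f σ c m u w) (hind : Indecomposable f) (hσ : IsAsymmetry f σ)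
    (hf : f.Nondegenerate) (hc : c ≠ 0) : finrank F V = m + m := by
  have : Nonempty (Fin m ⊕ Fin m) := ⟨Sum.inl ⟨0, h.pos⟩⟩
  have htop := hind.span_eq_top hσ hf h.apply_family_mem (h.gram_injective hσ hc)
  rw [← finrank_top, ← htop, finrank_span_eq_card (h.linearIndependent hσ hc)]
  simp

theorem HyperbolicPair.span_eq_top [FiniteDimensional F V] {c : F} {m : ℕ} {u w : V}
    (h : HyperbolicPair f σ c m u w) (hσ : IsAsymmetry f σ) (hc : c ≠ 0)
    (hm : finrank F V = m + m) :
    Submodule.span F (Set.range (HyperbolicPair.family σ c m u w)) = ⊤ :=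
  (h.linearIndependent hσ hc).span_eq_top_of_card_eq_finrank' (by simp [hm])

/-! ### The block matrices and their correspondence with hyperbolic pairs. -/

/-- The bilinear relations expressed by the Gram matrix `blockMatrix F m c`. -/
structure BlockFamily (f : LinearMap.BilinForm F V) (c : F) (m : ℕ) (e h : Fin m → V) : Prop where
  left_left : ∀ i j, f (e i) (e j) = 0
  right_right : ∀ i j, f (h i) (h j) = 0
  right_left : ∀ i j, f (h i) (e j) = if i = j then 1 else 0
  left_right : ∀ i j, f (e i) (h j) = jordanBlock F m c i j

namespace BlockFamily

variable {c : F} {m : ℕ} {e h : Fin m → V}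

theorem linearIndependent (H : BlockFamily f c m e h) : LinearIndependent F (Sum.elim e h) := by
  rw [Fintype.linearIndependent_iff]
  intro a ha
  rw [Fintype.sum_sum_type] at ha
  simp only [Sum.elim_inl, Sum.elim_inr] at ha
  rintro (k | k)
  · have := congrArg (f (h k)) ha
    simpa [H.right_left, H.right_right] using this
  · have := congrArg (fun x => f x (e k)) ha
    simpa [H.right_left, H.left_left] using this

theorem apply_elim (H : BlockFamily f c m e h) (i j : Fin m ⊕ Fin m) :
    f (Sum.elim e h i) (Sum.elim e h j) =
      Matrix.fromBlocks 0 (jordanBlock F m c) 1 0 i j := by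
  rcases i with i | i <;> rcases j with j | j
  · exact H.left_left i j
  · exact H.left_right i j
  · rw [Sum.elim_inl, Sum.elim_inr, H.right_left, Matrix.fromBlocks_apply₂₁, Matrix.one_apply]
  · exact H.right_right i j

theorem exists_basis [FiniteDimensional F V] (H : BlockFamily f c m e h)
    (hm : finrank F V = m + m) :
    ∃ b : Basis (Fin (m + m)) F V, LinearMap.BilinForm.toMatrix b f = blockMatrix F m c := by
  refine ⟨(basisOfLinearIndependentOfCardEqFinrank' _ H.linearIndependent
    (by rw [hm, Fintype.card_sum, Fintype.card_fin])).reindex finSumFinEquiv, ?_⟩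
  ext i j
  rw [LinearMap.BilinForm.toMatrix_apply, blockMatrix, Matrix.reindex_apply,
    Matrix.submatrix_apply, ← H.apply_elim, Basis.reindex_apply, Basis.reindex_apply]
  simp only [coe_basisOfLinearIndependentOfCardEqFinrank']

theorem of_basis {b : Basis (Fin (m + m)) F V}
    (hb : LinearMap.BilinForm.toMatrix b f = blockMatrix F m c) :
    BlockFamily f c m (fun i => b (finSumFinEquiv (Sum.inl i)))
      fun i => b (finSumFinEquiv (Sum.inr i)) := by
  have key : ∀ i j, f (b (finSumFinEquiv i)) (b (finSumFinEquiv j)) =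
      Matrix.fromBlocks 0 (jordanBlock F m c) 1 0 i j := fun i j => by
    have := congrFun (congrFun hb (finSumFinEquiv i)) (finSumFinEquiv j)
    rw [LinearMap.BilinForm.toMatrix_apply] at this
    rw [this, blockMatrix, Matrix.reindex_apply, Matrix.submatrix_apply, Equiv.symm_apply_apply,
      Equiv.symm_apply_apply]
  refine ⟨fun i j => key _ _, fun i j => key _ _, fun i j => ?_, fun i j => key _ _⟩
  rw [key, Matrix.fromBlocks_apply₂₁, Matrix.one_apply]

/-- The action of `σ` is known only through `f u (σ v) = f v u`; this allows identities between
vectors to be checked by pairing with the family. -/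
theorem eq_of_apply_eq [FiniteDimensional F V] (H : BlockFamily f c m e h)
    (hm : finrank F V = m + m) (hf : f.Nondegenerate) {x y : V}
    (he : ∀ i, f (e i) x = f (e i) y) (hh : ∀ i, f (h i) x = f (h i) y) : x = y := by
  have htop : Submodule.span F (Set.range (Sum.elim e h)) = ⊤ :=
    H.linearIndependent.span_eq_top_of_card_eq_finrank' (by simp [hm])
  have : f.flip x = f.flip y := by
    refine LinearMap.ext_on_range htop ?_
    rintro (i | i)
    · exact he i
    · exact hh i
  refine sub_eq_zero.mp (hf.2 _ fun z => ?_)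
  rw [map_sub, sub_eq_zero]
  exact LinearMap.congr_fun this z

/-- The pair is `u = e_{m-1}`, `w = h_0`: the shift by `c` lowers the index of `e`, and its top
power sends `u` to `e_0`, which pairs to `1` with `h_0`. -/
theorem exists_hyperbolicPair [FiniteDimensional F V] (H : BlockFamily f c m e h)
    (hm : finrank F V = m + m) (hf : f.Nondegenerate) (hσ : IsAsymmetry f σ) (hc : c ≠ 0)
    (h0 : 0 < m) : ∃ u w, HyperbolicPair f σ c m u w := by
  have shift_e : ∀ (i : ℕ) (hi : i + 1 < m), shift σ c (e ⟨i + 1, hi⟩) = e ⟨i, by omega⟩ := by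
    intro i hi
    refine H.eq_of_apply_eq hm hf (fun j => ?_) fun j => ?_
    · rw [hσ.apply_shift, H.left_left, H.left_left, H.left_left, mul_zero, sub_zero]
    · rw [hσ.apply_shift, H.left_right, H.right_left, H.right_left, jordanBlock, Matrix.of_apply]
      simp only [Fin.ext_iff]
      split_ifs <;> first | omega | contradiction | simp
  have shift_e_zero : shift σ c (e ⟨0, h0⟩) = 0 := by
    refine H.eq_of_apply_eq hm hf (fun j => ?_) fun j => ?_
    · rw [hσ.apply_shift, H.left_left, H.left_left, mul_zero, sub_zero, map_zero]
    · rw [hσ.apply_shift, H.left_right, H.right_left, jordanBlock, Matrix.of_apply, map_zero]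
      simp only [Fin.ext_iff]
      split_ifs <;> first | omega | contradiction | simp
  -- The shift by `c⁻¹` does not simply raise the index of `h`; a factor `σ` appears. It is
  -- harmless, because `σ` is an isometry and isotropy of the powers is preserved.
  have shift_h : ∀ (i : ℕ) (hi : i + 1 < m),
      shift σ c⁻¹ (h ⟨i, by omega⟩) = -c⁻¹ • σ (h ⟨i + 1, hi⟩) := by
    intro i hi
    refine H.eq_of_apply_eq hm hf (fun j => ?_) fun j => ?_
    · rw [hσ.apply_shift, map_smul, hσ, H.left_right, H.right_left, H.right_left, jordanBlock,
        Matrix.of_apply]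
      simp only [Fin.ext_iff]
      split_ifs <;> first | omega | contradiction | simp [hc]
    · rw [hσ.apply_shift, map_smul, hσ, H.right_right, H.right_right, H.right_right, mul_zero,
        sub_zero, smul_zero]
  have shift_h_last : shift σ c⁻¹ (h ⟨m - 1, by omega⟩) = 0 := by
    refine H.eq_of_apply_eq hm hf (fun j => ?_) fun j => ?_
    · rw [hσ.apply_shift, H.left_right, H.right_left, jordanBlock, Matrix.of_apply, map_zero]
      simp only [Fin.ext_iff]
      split_ifs <;> first | omega | contradiction | simp [hc]
    · rw [hσ.apply_shift, H.right_right, H.right_right, mul_zero, sub_zero, map_zero]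
  have pow_e : ∀ k (hk : k < m),
      (shift σ c ^ k) (e ⟨m - 1, by omega⟩) = e ⟨m - 1 - k, by omega⟩ := by
    intro k
    induction k with
    | zero => exact fun _ => rfl
    | succ k ih =>
      intro hk
      rw [pow_succ_apply, ih (by omega), ← shift_e (m - 1 - (k + 1)) (by omega)]
      congr 3
      omega
  have pow_h : ∀ k (hk : k < m), (shift σ c⁻¹ ^ k) (h ⟨0, h0⟩) =
      (-c⁻¹) ^ k • (σ ^ k) (h ⟨k, hk⟩) := by
    intro k
    induction k with
    | zero => simp
    | succ k ih =>
      intro hk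
      rw [pow_succ_apply, ih (by omega), map_smul,
        ← pow_shift_comm, shift_h k hk, map_smul, smul_smul, ← pow_succ, ← pow_succ_apply']
  have pow_e_last : (shift σ c ^ m) (e ⟨m - 1, by omega⟩) = 0 := by
    obtain ⟨n, rfl⟩ : ∃ n, m = n + 1 := ⟨m - 1, by omega⟩
    rw [pow_succ_apply, pow_e n (by omega)]
    simpa using shift_e_zero
  have pow_h_last : (shift σ c⁻¹ ^ m) (h ⟨0, h0⟩) = 0 := by
    obtain ⟨n, rfl⟩ : ∃ n, m = n + 1 := ⟨m - 1, by omega⟩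
    rw [pow_succ_apply, pow_h n (by omega), map_smul,
      ← pow_shift_comm]
    simp only [Nat.add_sub_cancel] at shift_h_last
    rw [shift_h_last, map_zero, smul_zero]
  have iso_pow : ∀ k x, f ((σ ^ k) x) ((σ ^ k) x) = f x x := by
    intro k x
    induction k with
    | zero => rfl
    | succ k ih => rw [pow_succ_apply, hσ.isometry, ih]
  refine ⟨e ⟨m - 1, by omega⟩, h ⟨0, h0⟩, pow_e_last, pow_h_last, fun k => ?_, fun k => ?_, ?_⟩
  · rcases lt_or_ge k m with hk | hk
    · rw [pow_e k hk, H.left_left]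
    · rw [pow_apply_eq_zero_of_le pow_e_last hk, map_zero]
  · rcases lt_or_ge k m with hk | hk
    · rw [pow_h k hk, map_smul, map_smul, LinearMap.smul_apply, iso_pow, H.right_right, smul_zero,
        smul_zero]
    · rw [pow_apply_eq_zero_of_le pow_h_last hk, map_zero]
  · rw [pow_e _ (by omega), H.right_left, if_pos (by simp)]
    exact one_ne_zero

end BlockFamily

theorem nondegenerate_of_blockMatrix {m : ℕ} {c : F} (hc : c ≠ 0) {b : Basis (Fin (m + m)) F V}
    (hb : LinearMap.BilinForm.toMatrix b f = blockMatrix F m c) : f.Nondegenerate := by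
  have hJ : (jordanBlock F m c).det ≠ 0 := by
    rw [Matrix.det_of_isLowerTriangular]
    · simp [jordanBlock, hc]
    · intro i j hij
      have : (i : ℕ) < j := hij
      rw [jordanBlock, Matrix.of_apply, if_neg (by rw [Fin.ext_iff]; omega), if_neg (by omega)]
  refine LinearMap.BilinForm.nondegenerate_of_det_ne_zero f b ?_
  rw [hb, blockMatrix, Matrix.det_reindex_self]
  refine (Matrix.isUnit_det_of_right_inverse (B := Matrix.fromBlocks 0 1
    (jordanBlock F m c)⁻¹ 0) ?_).ne_zero
  rw [Matrix.fromBlocks_multiply, Matrix.mul_nonsing_inv _ (isUnit_iff_ne_zero.mpr hJ)]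
  simp

/-- Take the powers of the shift on `u` in descending order as `e`, and the dual basis in the span
of the powers on `w` as `h`. Then `f (e i) (h j) = f (h j) (σ (e i))` with `σ (e i) = e (i - 1) + c
• e i`, which is exactly the Jordan block. -/
theorem HyperbolicPair.exists_basis [FiniteDimensional F V] {c : F} {m : ℕ} {u w : V}
    (h : HyperbolicPair f σ c m u w) (hσ : IsAsymmetry f σ) (hc : c ≠ 0)
    (hm : finrank F V = m + m) :
    ∃ b : Basis (Fin (m + m)) F V, LinearMap.BilinForm.toMatrix b f = blockMatrix F m c := by
  let e : Fin m → V := fun i => (shift σ c ^ (m - 1 - i : ℕ)) u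
  let φ : (Fin m → F) →ₗ[F] (Fin m → F) :=
    Matrix.mulVecLin (Matrix.of fun i j : Fin m => f ((shift σ c⁻¹ ^ (j : ℕ)) w) (e i))
  have hφ : Function.Injective φ := by
    -- Reversing the index of `e` turns the pairing matrix into an antitriangular one.
    refine (injective_iff_map_eq_zero _).mpr fun a ha => eq_zero_of_antitriangular
      (B := fun k i => f ((shift σ c⁻¹ ^ i) w) ((shift σ c ^ k) u))
      (fun k i hki => hσ.apply_pow_eq_zero hc h.pow_left w (by omega))
      (fun k i hki => hσ.apply_pow_ne_zero hc h.pow_left h.pairing (by omega)) fun k hk => ?_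
    have := congrFun ha ⟨m - 1 - k, by omega⟩
    simp only [φ, e, Matrix.mulVecLin_apply, Matrix.mulVec, dotProduct, Matrix.of_apply,
      show m - 1 - (m - 1 - k) = k by omega] at this
    exact this
  choose g hg using fun j => LinearMap.injective_iff_surjective.mp hφ (Pi.single j 1)
  have hhe : ∀ i j, f (∑ k, g i k • (shift σ c⁻¹ ^ (k : ℕ)) w) (e j) = if i = j then 1 else 0 := by
    intro i j
    have := congrFun (hg i) j
    simp only [φ, Matrix.mulVecLin_apply, Matrix.mulVec, dotProduct, Matrix.of_apply,
      Pi.single_apply] at this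
    simp only [map_sum, map_smul, LinearMap.sum_apply, LinearMap.smul_apply, smul_eq_mul,
      eq_comm (a := i)]
    rw [← this]
    exact Finset.sum_congr rfl fun k _ => mul_comm _ _
  refine BlockFamily.exists_basis (e := e) (h := fun j => ∑ k, g j k • (shift σ c⁻¹ ^ (k : ℕ)) w)
    ⟨fun i j => ?_, fun i j => ?_, hhe, fun i j => ?_⟩ hm
  · exact hσ.isotropic_of_diagonal hc h.isotropic_left _ _
  · simp [hσ.isotropic_of_diagonal (inv_ne_zero hc) h.isotropic_right]
  · rw [← hσ, apply_eq_shift_add σ c, map_add, map_smul, hhe, ← pow_succ_apply, jordanBlock,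
      Matrix.of_apply]
    rcases Nat.eq_zero_or_pos (i : ℕ) with hi | hi
    · rw [hi, show m - 1 - 0 + 1 = m by have := h.pos; omega, h.pow_left, map_zero, zero_add,
        if_neg (by omega : ¬ 0 = (j : ℕ) + 1)]
      simp [eq_comm]
    · have : (shift σ c ^ (m - 1 - (i : ℕ) + 1)) u = e ⟨i - 1, by omega⟩ := by
        simp only [e]
        congr 2
        omega
      rw [this, hhe]
      by_cases hij : i = j
      · subst hij
        rw [if_neg (by rw [Fin.ext_iff]; simp only; omega)]
        simp
      · rw [if_neg (Ne.symm hij), if_neg hij, smul_zero, add_zero]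
        congr 1
        rw [Fin.ext_iff, eq_iff_iff]
        simp only
        omega

end SplitForm

/-! ### Orthogonality of eigenspaces, adjustment of generators, indecomposability. -/

namespace SplitForm

open Module

variable {F V : Type*} [Field F] [AddCommGroup V] [Module F V]
  {f : LinearMap.BilinForm F V} {σ : End F V}

theorem shift_mem {P : Submodule F V} (hP : ∀ p ∈ P, σ p ∈ P) (c : F) {p : V} (hp : p ∈ P) :
    shift σ c p ∈ P :=
  P.sub_mem (hP p hp) (P.smul_mem _ hp)

theorem shift_pow_mem {P : Submodule F V} (hP : ∀ p ∈ P, σ p ∈ P) (c : F) (k : ℕ) {p : V}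
    (hp : p ∈ P) : (shift σ c ^ k) p ∈ P := by
  induction k with
  | zero => exact hp
  | succ k ih => rw [pow_succ_apply]; exact shift_mem hP c ih

namespace IsAsymmetry

/-- Generalized eigenspaces are orthogonal unless their eigenvalues are inverse to each other. -/
theorem apply_eq_zero_of_mul_ne_one (hσ : IsAsymmetry f σ) {c d : F} (hcd : c * d ≠ 1) {a b : ℕ}
    {x y : V} (hx : (shift σ c ^ a) x = 0) (hy : (shift σ d ^ b) y = 0) : f x y = 0 := by
  induction a generalizing b x y with
  | zero =>
    have : x = 0 := hx
    rw [this, map_zero, LinearMap.zero_apply]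
  | succ a iha =>
    induction b generalizing x y with
    | zero =>
      have : y = 0 := hy
      rw [this, map_zero]
    | succ b ihb =>
      rw [pow_succ_apply'] at hx hy
      have h := hσ.isometry x y
      rw [apply_eq_shift_add σ c x, apply_eq_shift_add σ d y] at h
      simp only [map_add, LinearMap.add_apply, map_smul, LinearMap.smul_apply, smul_eq_mul] at h
      have h1 : f (shift σ c x) y = 0 := iha (b := b + 1) hx (by rw [pow_succ_apply', hy])
      have h2 : f (shift σ c x) (shift σ d y) = 0 := iha hx hy
      have h3 : f x (shift σ d y) = 0 := ihb (by rw [pow_succ_apply', hx]) hy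
      rw [h1, h2, h3] at h
      have h4 : (c * d - 1) * f x y = 0 := by linear_combination h
      exact (mul_eq_zero.mp h4).resolve_left (sub_ne_zero.mpr hcd)

variable {c : F} {m : ℕ}

theorem apply_pow_eq_zero' (hσ : IsAsymmetry f σ) (hc : c * c = 1) {v : V}
    (hv : (shift σ c ^ m) v = 0) (u : V) {a b : ℕ} (hab : m ≤ a + b) :
    f ((shift σ c ^ a) u) ((shift σ c ^ b) v) = 0 := by
  have h := hσ.apply_pow_eq_zero (left_ne_zero_of_mul_eq_one hc) hv u hab
  rwa [← eq_inv_of_mul_eq_one_left hc] at h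

theorem apply_pow_eq' (hσ : IsAsymmetry f σ) (hc : c * c = 1) {v : V}
    (hv : (shift σ c ^ m) v = 0) (u : V) {a b : ℕ} (hab : a + b + 1 = m) :
    f ((shift σ c ^ a) u) ((shift σ c ^ b) v) = (-1) ^ a * f u ((shift σ c ^ (m - 1)) v) := by
  have h := hσ.apply_pow_eq (left_ne_zero_of_mul_eq_one hc) hv u hab
  rwa [← eq_inv_of_mul_eq_one_left hc, sq, hc] at h

theorem apply_pow_swap' (hσ : IsAsymmetry f σ) (hc : c * c = 1) (hm : 0 < m)
    {u w : V} (hu : (shift σ c ^ m) u = 0) (hw : (shift σ c ^ m) w = 0) :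
    f u ((shift σ c ^ (m - 1)) w) = c * (-1) ^ (m - 1) * f w ((shift σ c ^ (m - 1)) u) := by
  have hc' := eq_inv_of_mul_eq_one_left hc
  have h := hσ.apply_pow_swap (left_ne_zero_of_mul_eq_one hc) hm hu (w := w) (by rwa [← hc'])
  rwa [← hc', sq, hc] at h

/-- The two cross terms merge through `f y z = f z (N y) + c * f z y`, so the linear coefficient
only involves pairings of `u` against `v`, which are controlled in top degree. -/
theorem apply_add_smul_pow (hσ : IsAsymmetry f σ) (u v : V) (x : F) (s j : ℕ) :
    f ((shift σ c ^ j) (u + x • (shift σ c ^ s) v)) ((shift σ c ^ j) (u + x • (shift σ c ^ s) v)) =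
      f ((shift σ c ^ j) u) ((shift σ c ^ j) u) +
        x * ((1 + c) * f ((shift σ c ^ j) u) ((shift σ c ^ (j + s)) v) +
          f ((shift σ c ^ j) u) ((shift σ c ^ (j + s + 1)) v)) +
        x ^ 2 * f ((shift σ c ^ (j + s)) v) ((shift σ c ^ (j + s)) v) := by
  have h : f ((shift σ c ^ (j + s)) v) ((shift σ c ^ j) u) =
      f ((shift σ c ^ j) u) ((shift σ c ^ (j + s + 1)) v) +
        c * f ((shift σ c ^ j) u) ((shift σ c ^ (j + s)) v) := by
    rw [pow_succ_apply, hσ.apply_shift]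
    ring
  simp only [map_add, map_smul, LinearMap.add_apply, LinearMap.smul_apply, smul_eq_mul,
    pow_add_apply, h]
  ring

/-- The value `f (N ^ k u) (N ^ k u)` can be prescribed by adding to `u` a suitable multiple of
a power of `N` applied to `v`, keeping the analogous values for higher exponents. -/
theorem exists_adjust_step (hF : QuadraticallyClosed F) (hσ : IsAsymmetry f σ)
    (hc : c = -1 ∨ c = 1 ∧ (2 : F) ≠ 0) {k : ℕ} (hk : 2 * k + 2 ≤ m) {u v : V}
    (hv : (shift σ c ^ m) v = 0) (huv : f u ((shift σ c ^ (m - 1)) v) ≠ 0) (a : F) :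
    ∃ (s : ℕ) (x : F), m ≤ 2 * k + s + 2 ∧
      f ((shift σ c ^ k) (u + x • (shift σ c ^ s) v))
        ((shift σ c ^ k) (u + x • (shift σ c ^ s) v)) = a ∧
      ∀ j, k < j → f ((shift σ c ^ j) (u + x • (shift σ c ^ s) v))
        ((shift σ c ^ j) (u + x • (shift σ c ^ s) v)) =
          f ((shift σ c ^ j) u) ((shift σ c ^ j) u) := by
  have hcc : c * c = 1 := by rcases hc with rfl | ⟨rfl, -⟩ <;> ring
  have hsign : ((-1 : F) ^ k * f u ((shift σ c ^ (m - 1)) v)) ≠ 0 :=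
    mul_ne_zero (pow_ne_zero _ (neg_ne_zero.mpr one_ne_zero)) huv
  obtain ⟨s, hs, hb, hj⟩ : ∃ s, m ≤ 2 * k + s + 2 ∧
      (1 + c) * f ((shift σ c ^ k) u) ((shift σ c ^ (k + s)) v) +
          f ((shift σ c ^ k) u) ((shift σ c ^ (k + s + 1)) v) ≠ 0 ∧
      ∀ j, k < j → (1 + c) * f ((shift σ c ^ j) u) ((shift σ c ^ (j + s)) v) +
          f ((shift σ c ^ j) u) ((shift σ c ^ (j + s + 1)) v) = 0 := by
    rcases hc with rfl | ⟨rfl, h2⟩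
    -- For `c = -1` the factor `1 + c` vanishes, so `s` is chosen to put the second cross term, of
    -- total degree `2k + s + 1`, in degree `m - 1`.
    · refine ⟨m - 2 - 2 * k, by omega, ?_, fun j hj => ?_⟩
      · rw [hσ.apply_pow_eq' hcc hv u (a := k) (b := k + _ + 1) (by omega), add_neg_cancel, zero_mul, zero_add]
        exact hsign
      · rw [hσ.apply_pow_eq_zero' hcc hv u (a := j) (b := j + _ + 1) (by omega), add_neg_cancel,
          zero_mul, zero_add]
    -- For `c = 1` the first cross term, of total degree `2k + s` and with factor `2 ≠ 0`, is put in
    -- degree `m - 1`; the second one then vanishes.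
    · refine ⟨m - 1 - 2 * k, by omega, ?_, fun j hj => ?_⟩
      · rw [hσ.apply_pow_eq' hcc hv u (by omega),
          hσ.apply_pow_eq_zero' hcc hv u (by omega), add_zero, one_add_one_eq_two]
        exact mul_ne_zero h2 hsign
      · rw [hσ.apply_pow_eq_zero' hcc hv u (a := j) (b := j + _ + 1) (by omega),
          hσ.apply_pow_eq_zero' hcc hv u (by omega), mul_zero, zero_add]
  obtain ⟨x, hx⟩ := hF.exists_root (f ((shift σ c ^ k) u) ((shift σ c ^ k) u) - a) _
    (f ((shift σ c ^ (k + s)) v) ((shift σ c ^ (k + s)) v)) hb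
  refine ⟨s, x, hs, ?_, fun j hkj => ?_⟩
  · rw [hσ.apply_add_smul_pow]
    linear_combination hx
  · rw [hσ.apply_add_smul_pow, hj j hkj, hσ.apply_pow_eq_zero' hcc hv _ (by omega)]
    ring

/-- The values `f (N ^ j u) (N ^ j u)` can be prescribed for all `j < K`. -/
theorem exists_adjust (hF : QuadraticallyClosed F) (hσ : IsAsymmetry f σ)
    (hc : c = -1 ∨ c = 1 ∧ (2 : F) ≠ 0) {K : ℕ} (hK : 2 * K ≤ m) {u v : V}
    (hu : (shift σ c ^ m) u = 0) (hv : (shift σ c ^ m) v = 0)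
    (huv : f u ((shift σ c ^ (m - 1)) v) ≠ 0)
    (hvv : f v ((shift σ c ^ (m - 1)) v) = 0 ∨ 2 * K + 1 ≤ m) (a : ℕ → F) :
    ∃ u', (shift σ c ^ m) u' = 0 ∧ f u' ((shift σ c ^ (m - 1)) v) ≠ 0 ∧
      (∀ j < K, f ((shift σ c ^ j) u') ((shift σ c ^ j) u') = a j) ∧
      (∀ j, K ≤ j → f ((shift σ c ^ j) u') ((shift σ c ^ j) u') =
        f ((shift σ c ^ j) u) ((shift σ c ^ j) u)) ∧
      ∀ P : Submodule F V, (∀ p ∈ P, σ p ∈ P) → u ∈ P → v ∈ P → u' ∈ P := by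
  have hcc : c * c = 1 := by rcases hc with rfl | ⟨rfl, -⟩ <;> ring
  -- The exponents are treated downwards from `K - 1`, since each adjustment preserves the values at
  -- larger exponents only.
  suffices H : ∀ d ≤ K, ∃ u', (shift σ c ^ m) u' = 0 ∧ f u' ((shift σ c ^ (m - 1)) v) ≠ 0 ∧
      (∀ j < K, K ≤ j + d → f ((shift σ c ^ j) u') ((shift σ c ^ j) u') = a j) ∧
      (∀ j, K ≤ j → f ((shift σ c ^ j) u') ((shift σ c ^ j) u') =
        f ((shift σ c ^ j) u) ((shift σ c ^ j) u)) ∧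
      ∀ P : Submodule F V, (∀ p ∈ P, σ p ∈ P) → u ∈ P → v ∈ P → u' ∈ P by
    obtain ⟨u', h1, h2, h3, h4, h5⟩ := H K le_rfl
    exact ⟨u', h1, h2, fun j hj => h3 j hj (by omega), h4, h5⟩
  intro d
  induction d with
  | zero => exact fun _ => ⟨u, hu, huv, fun j h1 h2 => by omega, fun _ _ => rfl, fun _ _ h _ => h⟩
  | succ d ih =>
    intro hd
    obtain ⟨u', h1, h2, h3, h4, h5⟩ := ih (by omega)
    obtain ⟨s, x, hs, hk, hj⟩ := hσ.exists_adjust_step hF hc (k := K - (d + 1)) (by omega) hv h2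
      (a (K - (d + 1)))
    refine ⟨u' + x • (shift σ c ^ s) v, ?_, ?_, fun j hjK hjd => ?_, fun j hjK => ?_,
      fun P hP huP hvP => ?_⟩
    · rw [map_add, h1, map_smul, pow_add_apply, pow_apply_eq_zero_of_le hv (by omega), smul_zero,
        add_zero]
    · suffices h : f ((shift σ c ^ s) v) ((shift σ c ^ (m - 1)) v) = 0 by
        rwa [map_add, map_smul, LinearMap.add_apply, LinearMap.smul_apply, h, smul_zero, add_zero]
      -- The pairing with `v` could change only if `s = 0`, which forces `m = 2K`; this is where
      -- `hvv` enters.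
      rcases Nat.eq_zero_or_pos s with rfl | hs0
      · exact hvv.resolve_right (by omega)
      · exact hσ.apply_pow_eq_zero' hcc hv v (by omega)
    · rcases Nat.lt_or_ge (K - (d + 1)) j with h | h
      · rw [hj j h]
        exact h3 j hjK (by omega)
      · obtain rfl : j = K - (d + 1) := by omega
        exact hk
    · rw [hj j (by omega), h4 j hjK]
    · exact P.add_mem (h5 P hP huP hvP) (P.smul_mem _ (shift_pow_mem hP c s hvP))

/-- Vectors which are paired nontrivially can be replaced by a hyperbolic pair. -/
theorem exists_hyperbolicPair (hF : QuadraticallyClosed F) (hσ : IsAsymmetry f σ) (hc0 : c ≠ 0)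
    (hc : c * c = 1 → ∀ x, (shift σ c ^ m) x = 0 → f x ((shift σ c ^ (m - 1)) x) = 0) {u w : V}
    (hu : (shift σ c ^ m) u = 0) (hw : (shift σ c⁻¹ ^ m) w = 0)
    (hwu : f w ((shift σ c ^ (m - 1)) u) ≠ 0) :
    ∃ u' w', HyperbolicPair f σ c m u' w' ∧
      ∀ P : Submodule F V, (∀ p ∈ P, σ p ∈ P) → u ∈ P → w ∈ P → u' ∈ P ∧ w' ∈ P := by
  by_cases hcc : c * c = 1
  · have hc' := eq_inv_of_mul_eq_one_left hcc
    replace hc := hc hcc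
    rw [← hc'] at hw
    have hm : 0 < m := by
      rcases Nat.eq_zero_or_pos m with rfl | hm
      · have : u = 0 := hu
        simp [this] at hwu
      · exact hm
    have hc1 : c = -1 ∨ c = 1 ∧ (2 : F) ≠ 0 := by
      by_cases h2 : (2 : F) = 0
      · left
        rcases mul_self_eq_one_iff.mp hcc with h | h
        · rw [h]
          linear_combination h2
        · exact h
      · exact (mul_self_eq_one_iff.mp hcc).symm.imp id fun h => ⟨h, h2⟩
    -- From `m / 2` on, the diagonal values have total degree at least `m`, except for degree `m -
    -- 1` when `m` is odd, where the alternating hypothesis gives zero.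
    have top : ∀ x, (shift σ c ^ m) x = 0 → ∀ j, m / 2 ≤ j →
        f ((shift σ c ^ j) x) ((shift σ c ^ j) x) = 0 := by
      intro x hx j hj
      rcases Nat.lt_or_ge (j + j) m with h | h
      · rw [hσ.apply_pow_eq' hcc hx x (by omega), hc x hx, mul_zero]
      · exact hσ.apply_pow_eq_zero' hcc hx x h
    have hsw : c * (-1) ^ (m - 1) ≠ 0 := mul_ne_zero hc0 (pow_ne_zero _ (by simp))
    -- First `w` is made isotropic with the help of `u`, then `u` with the help of the new `w'`,
    -- which is no longer touched.
    obtain ⟨w', h1, h2, h3, h4, h5⟩ := hσ.exists_adjust hF hc1 (K := m / 2) (by omega) hw hu hwu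
      (Or.inl (hc u hu)) 0
    obtain ⟨u', g1, g2, g3, g4, g5⟩ := hσ.exists_adjust hF hc1 (K := m / 2) (by omega) hu h1
      (by rw [hσ.apply_pow_swap' hcc hm hu h1]; exact mul_ne_zero hsw h2) (Or.inl (hc w' h1)) 0
    refine ⟨u', w', ⟨g1, by rwa [← hc'], fun k => ?_, fun k => ?_, ?_⟩, fun P hP huP hwP => ?_⟩
    · rcases Nat.lt_or_ge k (m / 2) with hk | hk
      · exact g3 k hk
      · exact top u' g1 k hk
    · rw [← hc']
      rcases Nat.lt_or_ge k (m / 2) with hk | hk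
      · exact h3 k hk
      · exact top w' h1 k hk
    · rw [hσ.apply_pow_swap' hcc hm h1 g1]
      exact mul_ne_zero hsw g2
    · exact ⟨g5 P hP huP (h5 P hP hwP huP), h5 P hP hwP huP⟩
  · refine ⟨u, w, ⟨hu, hw, fun k => ?_, fun k => ?_, hwu⟩, fun P _ huP hwP => ⟨huP, hwP⟩⟩
    · have : (shift σ c ^ m) ((shift σ c ^ k) u) = 0 := by
        rw [pow_add_apply, pow_apply_eq_zero_of_le hu (by omega)]
      exact hσ.apply_eq_zero_of_mul_ne_one hcc this this
    · have : (shift σ c⁻¹ ^ m) ((shift σ c⁻¹ ^ k) w) = 0 := by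
        rw [pow_add_apply, pow_apply_eq_zero_of_le hw (by omega)]
      refine hσ.apply_eq_zero_of_mul_ne_one (fun h => hcc ?_) this this
      rw [← mul_inv, inv_eq_one] at h
      exact h

end IsAsymmetry

theorem HyperbolicPair.apply_self_eq_zero [FiniteDimensional F V] {c : F} {m : ℕ} {u w : V}
    (h : HyperbolicPair f σ c m u w) (hσ : IsAsymmetry f σ) (hcc : c * c = 1)
    (hm : finrank F V = m + m) (hsign : c * (-1) ^ (m - 1) = -1) (x : V) :
    f x ((shift σ c ^ (m - 1)) x) = 0 := by
  have hc := left_ne_zero_of_mul_eq_one hcc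
  have hc' := eq_inv_of_mul_eq_one_left hcc
  have hx : x ∈ Submodule.span F (Set.range (HyperbolicPair.family σ c m u w)) := by
    rw [h.span_eq_top hσ hc hm]
    trivial
  obtain ⟨a, rfl⟩ := (Submodule.mem_span_range_iff_exists_fun F).mp hx
  rw [Fintype.sum_sum_type]
  simp only [family, Sum.elim_inl, Sum.elim_inr, ← hc']
  have hw := h.pow_right
  rw [← hc'] at hw
  have left : ∀ i j, f ((shift σ c ^ i) u) ((shift σ c ^ j) u) = 0 :=
    hσ.isotropic_of_diagonal hc h.isotropic_left
  have right : ∀ i j, f ((shift σ c ^ i) w) ((shift σ c ^ j) w) = 0 := by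
    have := h.isotropic_right
    rw [← hc'] at this
    exact hσ.isotropic_of_diagonal hc this
  set p := ∑ i : Fin m, a (Sum.inl i) • (shift σ c ^ (i : ℕ)) u
  set q := ∑ i : Fin m, a (Sum.inr i) • (shift σ c ^ (i : ℕ)) w
  have hp : (shift σ c ^ m) p = 0 := by
    simp only [p, map_sum, map_smul, pow_add_apply]
    exact Finset.sum_eq_zero fun i _ => by
      rw [pow_apply_eq_zero_of_le h.pow_left (by omega), smul_zero]
  have hq : (shift σ c ^ m) q = 0 := by
    simp only [q, map_sum, map_smul, pow_add_apply]
    exact Finset.sum_eq_zero fun i _ => by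
      rw [pow_apply_eq_zero_of_le hw (by omega), smul_zero]
  have hpp : f p ((shift σ c ^ (m - 1)) p) = 0 := by
    simp [p, pow_add_apply, left]
  have hqq : f q ((shift σ c ^ (m - 1)) q) = 0 := by
    simp [q, pow_add_apply, right]
  -- Only the two cross terms survive, and the sign `-1` makes them cancel.
  rw [map_add, map_add, map_add, LinearMap.add_apply, LinearMap.add_apply, hpp, hqq,
    hσ.apply_pow_swap' hcc h.pos hp hq, hsign]
  ring

/-- The summands of an orthogonal decomposition are stable under the asymmetry. -/
theorem apply_mem_of_orthogonal (hσ : IsAsymmetry f σ) (hf : f.Nondegenerate)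
    {U₁ U₂ : Submodule F V} (hU : IsCompl U₁ U₂)
    (horth : ∀ x ∈ U₁, ∀ y ∈ U₂, f x y = 0 ∧ f y x = 0) {x : V} (hx : x ∈ U₁) : σ x ∈ U₁ := by
  have mem : ∀ v, ∃ y ∈ U₁, ∃ z ∈ U₂, y + z = v := fun v =>
    Submodule.mem_sup.mp (hU.sup_eq_top ▸ Submodule.mem_top)
  obtain ⟨y, hy, z, hz, hyz⟩ := mem (σ x)
  have : z = 0 := hf.2 z fun v => by
    obtain ⟨v₁, hv₁, v₂, hv₂, rfl⟩ := mem v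
    have h : f v₂ (y + z) = f x v₂ := by rw [hyz, hσ]
    rw [map_add, (horth y hy v₂ hv₂).2, zero_add, (horth x hx v₂ hv₂).1] at h
    rw [map_add, LinearMap.add_apply, (horth v₁ hv₁ z hz).1, h, zero_add]
  rw [← hyz, this, add_zero]
  exact hy

/-- To prove indecomposability of a form with a distinguished pairing `f w (N ^ k u)`, where
`u` and `w` are killed by polynomials in the asymmetry, it suffices to show that a summand in
which the components pair nontrivially is everything. -/
theorem indecomposable_of_pairing (hσ : IsAsymmetry f σ) (hf : f.Nondegenerate) {c d : F}
    {m k : ℕ} {u w : V} (hu : (shift σ c ^ m) u = 0) (hw : (shift σ d ^ m) w = 0)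
    (hwu : f w ((shift σ c ^ k) u) ≠ 0)
    (h : ∀ P : Submodule F V, (∀ p ∈ P, σ p ∈ P) → ∀ u' ∈ P, ∀ w' ∈ P,
      (shift σ c ^ m) u' = 0 → (shift σ d ^ m) w' = 0 → (u = w → u' = w') →
      f w' ((shift σ c ^ k) u') ≠ 0 → P = ⊤) : Indecomposable f := by
  intro U₁ U₂ hU horth
  have horth' : ∀ x ∈ U₂, ∀ y ∈ U₁, f x y = 0 ∧ f y x = 0 := fun x hx y hy =>
    (horth y hy x hx).symm
  have mem : ∀ v, ∃ y ∈ U₁, ∃ z ∈ U₂, y + z = v := fun v =>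
    Submodule.mem_sup.mp (hU.sup_eq_top ▸ Submodule.mem_top)
  choose p hp q hq hpq using mem
  have inv₁ : ∀ x ∈ U₁, σ x ∈ U₁ := fun x hx => apply_mem_of_orthogonal hσ hf hU horth hx
  have inv₂ : ∀ x ∈ U₂, σ x ∈ U₂ := fun x hx => apply_mem_of_orthogonal hσ hf hU.symm horth' hx
  have kill : ∀ (e : F) (v : V), (shift σ e ^ m) v = 0 →
      (shift σ e ^ m) (p v) = 0 ∧ (shift σ e ^ m) (q v) = 0 := by
    intro e v hv
    have h1 := shift_pow_mem inv₁ e m (hp v)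
    have h2 := shift_pow_mem inv₂ e m (hq v)
    rw [← hpq v, map_add, add_eq_zero_iff_eq_neg] at hv
    have h3 : (shift σ e ^ m) (p v) = 0 :=
      Submodule.disjoint_def.mp hU.disjoint _ h1 (by rw [hv]; exact U₂.neg_mem h2)
    rw [h3, eq_comm, neg_eq_zero] at hv
    exact ⟨h3, hv⟩
  -- By orthogonality the nonzero pairing is the sum of the pairings of the components in the two
  -- summands, so one of these is nonzero.
  by_cases h1 : f (p w) ((shift σ c ^ k) (p u)) = 0
  · left
    have htop := h U₂ inv₂ (q u) (hq u) (q w) (hq w) (kill c u hu).2 (kill d w hw).2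
      (congrArg q) fun h2 => hwu <| by
        rw [← hpq u, ← hpq w, map_add, map_add, map_add, LinearMap.add_apply,
          LinearMap.add_apply, h1, h2, (horth _ (hp w) _ (shift_pow_mem inv₂ c k (hq u))).1,
          (horth' _ (hq w) _ (shift_pow_mem inv₁ c k (hp u))).1]
        simp
    exact eq_bot_of_isCompl_top (htop ▸ hU)
  · right
    have htop := h U₁ inv₁ (p u) (hp u) (p w) (hp w) (kill c u hu).1 (kill d w hw).1
      (congrArg p) h1
    exact eq_bot_of_isCompl_top (htop ▸ hU).symm

/-- A form generated by a hyperbolic pair is indecomposable, provided that in the case of the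
eigenvalue `±1` the sign is right. -/
theorem HyperbolicPair.indecomposable [FiniteDimensional F V] (hF : QuadraticallyClosed F)
    {c : F} {m : ℕ} {u w : V}
    (h : HyperbolicPair f σ c m u w) (hσ : IsAsymmetry f σ) (hf : f.Nondegenerate) (hc : c ≠ 0)
    (hm : finrank F V = m + m) (hsign : c * c = 1 → c * (-1) ^ (m - 1) = -1) :
    Indecomposable f := by
  refine indecomposable_of_pairing hσ hf h.pow_left h.pow_right h.pairing
    fun P hP u₁ hu₁ w₁ hw₁ hpu hpw _ hpair => ?_
  obtain ⟨u', w', h', hmem⟩ := hσ.exists_hyperbolicPair hF hc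
    (fun hcc x _ => h.apply_self_eq_zero hσ hcc hm (hsign hcc) x) hpu hpw hpair
  obtain ⟨hu', hw'⟩ := hmem P hP hu₁ hw₁
  rw [eq_top_iff, ← h'.span_eq_top hσ hc hm, Submodule.span_le]
  rintro _ ⟨i | i, rfl⟩
  · exact shift_pow_mem hP c _ hu'
  · exact shift_pow_mem hP c⁻¹ _ hw'

end SplitForm

/-! ### Forms generated by a cyclic vector. -/

namespace SplitForm

open Module

theorem equivalent_of_gram {F V W ι : Type*} [Field F] [AddCommGroup V] [Module F V]
    [AddCommGroup W] [Module F W] {f : LinearMap.BilinForm F V} {g : LinearMap.BilinForm F W}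
    (b : Basis ι F V) (b' : Basis ι F W) (h : ∀ i j, f (b i) (b j) = g (b' i) (b' j)) :
    f.Equivalent g := by
  let e := b.equiv b' (Equiv.refl ι)
  have he : ∀ i, e (b i) = b' i := fun i => by simp [e]
  have : g.compl₁₂ e.toLinearMap e.toLinearMap = f := by
    refine LinearMap.ext_basis b b fun i j => ?_
    rw [LinearMap.compl₁₂_apply, LinearEquiv.coe_coe, he, he, h]
  exact ⟨{ e with map_app' := fun x y => LinearMap.congr_fun (LinearMap.congr_fun this x) y }⟩

/-- `v` generates a cyclic subspace of dimension `m`, which is non-degenerate when `c = c⁻¹`. -/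
structure CyclicVector {F V : Type*} [Field F] [AddCommGroup V] [Module F V]
    (f : LinearMap.BilinForm F V) (σ : End F V) (c : F) (m : ℕ) (v : V) : Prop where
  pow_eq_zero : (shift σ c ^ m) v = 0
  pairing : f v ((shift σ c ^ (m - 1)) v) ≠ 0

section Cyclic

variable {F V : Type*} [Field F] [AddCommGroup V] [Module F V]
  {f : LinearMap.BilinForm F V} {σ : End F V} {c : F} {m : ℕ} {v : V}

namespace CyclicVector

theorem pos (h : CyclicVector f σ c m v) : 0 < m := by
  rcases Nat.eq_zero_or_pos m with rfl | hm
  · refine absurd ?_ h.pairing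
    have : v = 0 := h.pow_eq_zero
    rw [this, map_zero, map_zero, LinearMap.zero_apply]
  · exact hm

theorem gram_injective (h : CyclicVector f σ c m v) (hσ : IsAsymmetry f σ) (hc : c * c = 1)
    (a : Fin m → F) (ha : ∀ k : Fin m, f ((shift σ c ^ (k : ℕ)) v)
      (∑ i : Fin m, a i • (shift σ c ^ (i : ℕ)) v) = 0) : a = 0 := by
  refine eq_zero_of_antitriangular (B := fun k i => f ((shift σ c ^ k) v) ((shift σ c ^ i) v))
    (fun k i hki => hσ.apply_pow_eq_zero' hc h.pow_eq_zero v hki)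
    (fun k i hki => ?_) fun k hk => ?_
  · rw [hσ.apply_pow_eq' hc h.pow_eq_zero v hki]
    exact mul_ne_zero (pow_ne_zero _ (by simp)) h.pairing
  · have := ha ⟨k, hk⟩
    simp only [map_sum, map_smul, smul_eq_mul] at this
    rw [← this]
    exact Finset.sum_congr rfl fun i _ => mul_comm _ _

theorem linearIndependent (h : CyclicVector f σ c m v) (hσ : IsAsymmetry f σ) (hc : c * c = 1) :
    LinearIndependent F fun i : Fin m => (shift σ c ^ (i : ℕ)) v :=
  linearIndependent_of_gram (f := f) (h.gram_injective hσ hc)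

theorem finrank_eq [FiniteDimensional F V] (h : CyclicVector f σ c m v)
    (hind : Indecomposable f) (hσ : IsAsymmetry f σ) (hf : f.Nondegenerate) (hc : c * c = 1) :
    finrank F V = m := by
  have : Nonempty (Fin m) := ⟨⟨0, h.pos⟩⟩
  have htop := hind.span_eq_top hσ hf (b := fun i : Fin m => (shift σ c ^ (i : ℕ)) v)
    (fun i => apply_mem_span_pow h.pow_eq_zero fun j hj => Submodule.subset_span
      (Set.mem_range_self (f := fun i : Fin m => (shift σ c ^ (i : ℕ)) v) ⟨j, hj⟩))
    (h.gram_injective hσ hc)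
  rw [← finrank_top, ← htop, finrank_span_eq_card (h.linearIndependent hσ hc), Fintype.card_fin]

theorem span_eq_top [FiniteDimensional F V] (h : CyclicVector f σ c m v)
    (hσ : IsAsymmetry f σ) (hc : c * c = 1) (hm : finrank F V = m) :
    Submodule.span F (Set.range fun i : Fin m => (shift σ c ^ (i : ℕ)) v) = ⊤ :=
  (h.linearIndependent hσ hc).span_eq_top_of_card_eq_finrank' (by simp [hm])

theorem indecomposable [FiniteDimensional F V] (h : CyclicVector f σ c m v)
    (hσ : IsAsymmetry f σ) (hf : f.Nondegenerate) (hc : c * c = 1) (hm : finrank F V = m) :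
    Indecomposable f := by
  refine indecomposable_of_pairing hσ hf h.pow_eq_zero h.pow_eq_zero h.pairing
    fun P hP u hu w _ hpu _ huw hpair => ?_
  rw [← huw rfl] at hpair
  have h' : CyclicVector f σ c m u := ⟨hpu, hpair⟩
  rw [eq_top_iff, ← h'.span_eq_top hσ hc hm, Submodule.span_le]
  rintro _ ⟨i, rfl⟩
  exact shift_pow_mem hP c _ hu

end CyclicVector

/-- With `t = (m - 1) / 2`, the degree `m - 1` is `t + t` for odd `m`, and `t + (t + 1)` for even
`m`; in the latter case `f y (N y) = (1 - c) * f y y`. -/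
theorem IsAsymmetry.apply_middle (hσ : IsAsymmetry f σ) (hc : c * c = 1) (hm : 0 < m) {x : V}
    (hx : (shift σ c ^ m) x = 0) :
    (if Odd m then 1 else 1 - c) *
      f ((shift σ c ^ ((m - 1) / 2)) x) ((shift σ c ^ ((m - 1) / 2)) x) =
        (-1) ^ ((m - 1) / 2) * f x ((shift σ c ^ (m - 1)) x) := by
  split_ifs with h
  · have := Nat.odd_iff.mp h
    rw [one_mul, hσ.apply_pow_eq' hc hx x (by omega)]
  · have := Nat.not_odd_iff.mp h
    rw [← hσ.apply_pow_eq' hc hx x (a := (m - 1) / 2) (b := (m - 1) / 2 + 1) (by omega),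
      pow_succ_apply, hσ.apply_shift]
    ring

/-- In which cases a cyclic vector normalizes its form. -/
def NormalizingSign (c : F) (m : ℕ) : Prop :=
  c = 1 ∧ (2 : F) ≠ 0 ∧ Odd m ∨ c = -1 ∧ (Odd m ∨ (2 : F) ≠ 0)

theorem IsAsymmetry.pairing_ne_zero_iff (hσ : IsAsymmetry f σ) (hc : NormalizingSign c m)
    (hm : 0 < m) {x : V} (hx : (shift σ c ^ m) x = 0) :
    f ((shift σ c ^ ((m - 1) / 2)) x) ((shift σ c ^ ((m - 1) / 2)) x) ≠ 0 ↔
      f x ((shift σ c ^ (m - 1)) x) ≠ 0 := by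
  have hcc : c * c = 1 := by rcases hc with ⟨rfl, -⟩ | ⟨rfl, -⟩ <;> ring
  have h := hσ.apply_middle hcc hm hx
  have h1 : (if Odd m then 1 else 1 - c) ≠ 0 := by
    split_ifs with hodd
    · exact one_ne_zero
    · rcases hc with ⟨rfl, -, hm⟩ | ⟨rfl, hm⟩
      · exact absurd hm hodd
      · rw [sub_neg_eq_add, one_add_one_eq_two]
        exact hm.resolve_left hodd
  have h2 : (-1 : F) ^ ((m - 1) / 2) ≠ 0 := pow_ne_zero _ (by simp)
  rw [not_iff_not]
  constructor
  · intro h0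
    rw [h0, mul_zero, eq_comm] at h
    exact (mul_eq_zero.mp h).resolve_left h2
  · intro h0
    rw [h0, mul_zero] at h
    exact (mul_eq_zero.mp h).resolve_left h1

/-- Two forms generated by cyclic vectors with the same parameters are equivalent. -/
theorem CyclicVector.equivalent [FiniteDimensional F V] (hF : QuadraticallyClosed F)
    {W : Type*} [AddCommGroup W] [Module F W] [FiniteDimensional F W]
    {g : LinearMap.BilinForm F W} {τ : End F W} {w : W}
    (hv : CyclicVector f σ c m v) (hw : CyclicVector g τ c m w)
    (hσ : IsAsymmetry f σ) (hτ : IsAsymmetry g τ) (hc : NormalizingSign c m)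
    (hV : finrank F V = m) (hW : finrank F W = m) : f.Equivalent g := by
  have hcc : c * c = 1 := by rcases hc with ⟨rfl, -⟩ | ⟨rfl, -⟩ <;> ring
  have hc1 : c = -1 ∨ c = 1 ∧ (2 : F) ≠ 0 := by
    rcases hc with ⟨h1, h2, -⟩ | ⟨h1, -⟩
    · exact Or.inr ⟨h1, h2⟩
    · exact Or.inl h1
  have hpar : Odd m ∨ 2 * ((m - 1) / 2) + 2 = m := by
    rcases Nat.even_or_odd m with h | h
    · have := Nat.even_iff.mp h
      have := hv.pos
      right
      omega
    · exact Or.inl h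
  obtain ⟨T, hT⟩ : ∃ T, T = (m - 1) / 2 := ⟨_, rfl⟩
  have hm := hv.pos
  have qv := (hσ.pairing_ne_zero_iff hc hm hv.pow_eq_zero).mpr hv.pairing
  have qw := (hτ.pairing_ne_zero_iff hc hm hw.pow_eq_zero).mpr hw.pairing
  rw [← hT] at qv qw
  -- The last diagonal value not forced to vanish, at exponent `T`, is matched by scaling `v` with a
  -- square root; the lower ones are then adjusted using `v` itself, and the higher ones vanish.
  obtain ⟨x, hx⟩ := hF.exists_sq (g ((shift τ c ^ T) w) ((shift τ c ^ T) w) /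
    f ((shift σ c ^ T) v) ((shift σ c ^ T) v))
  have hx0 : x ≠ 0 := by
    rintro rfl
    rw [zero_pow two_ne_zero] at hx
    exact div_ne_zero qw qv hx.symm
  have hxv : (shift σ c ^ m) (x • v) = 0 := by rw [map_smul, hv.pow_eq_zero, smul_zero]
  obtain ⟨u, h1, -, h3, h4, -⟩ := hσ.exists_adjust hF hc1 (K := T) (by omega) hxv hv.pow_eq_zero
    (by rw [map_smul]; exact mul_ne_zero hx0 hv.pairing) (Or.inr (by omega))
    fun j => g ((shift τ c ^ j) w) ((shift τ c ^ j) w)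
  have hdiag : ∀ j, f ((shift σ c ^ j) u) ((shift σ c ^ j) u) =
      g ((shift τ c ^ j) w) ((shift τ c ^ j) w) := by
    intro j
    rcases lt_trichotomy j T with hj | rfl | hj
    · exact h3 j hj
    · rw [h4 j le_rfl, map_smul, map_smul, map_smul, LinearMap.smul_apply, smul_eq_mul,
        smul_eq_mul, ← mul_assoc, ← sq, hx, div_mul_cancel₀ _ qv]
    · rw [hσ.apply_pow_eq_zero' hcc h1 u (by omega),
        hτ.apply_pow_eq_zero' hcc hw.pow_eq_zero w (by omega)]
  have hu : CyclicVector f σ c m u := by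
    refine ⟨h1, (hσ.pairing_ne_zero_iff hc hm h1).mp ?_⟩
    rw [← hT, hdiag]
    exact qw
  have hgram : ∀ i j, f ((shift σ c ^ i) u) ((shift σ c ^ j) u) =
      g ((shift τ c ^ i) w) ((shift τ c ^ j) w) := by
    intro i j
    refine sub_eq_zero.mp (eq_zero_of_diagonal (left_ne_zero_of_mul_eq_one hcc)
      (B := fun i j => f ((shift σ c ^ i) u) ((shift σ c ^ j) u) -
        g ((shift τ c ^ i) w) ((shift τ c ^ j) w)) (fun i j => ?_)
      (fun i => sub_eq_zero.mpr (hdiag i)) i j)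
    rw [pow_succ_apply, pow_succ_apply, hσ.apply_shift, hτ.apply_shift]
    ring
  refine equivalent_of_gram
    (basisOfLinearIndependentOfCardEqFinrank' _ (hu.linearIndependent hσ hcc) (by simp [hV]))
    (basisOfLinearIndependentOfCardEqFinrank' _ (hw.linearIndependent hτ hcc) (by simp [hW]))
    fun i j => ?_
  rw [coe_basisOfLinearIndependentOfCardEqFinrank', coe_basisOfLinearIndependentOfCardEqFinrank']
  exact hgram i j

end Cyclic

/-! ### The matrices `Gamma` and `GammaZero`. -/

section Antidiagonal

variable {F V : Type*} [Field F] [AddCommGroup V] [Module F V] {n : ℕ}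

/-- The relations shared by the matrices `Gamma` and `GammaZero`. -/
structure AntidiagonalBasis (f : LinearMap.BilinForm F V) (c : F) (b : Basis (Fin n) F V)
    (α β δ : ℕ → F) : Prop where
  apply_eq : ∀ i j : Fin n, f (b i) (b j) =
    (if (i : ℕ) + j + 1 = n then α i else 0) + if (i : ℕ) + j = n then β i else 0
  apply_sub : ∀ i j : Fin n, f (b j) (b i) - c * f (b i) (b j) =
    if (i : ℕ) + j = n then δ i else 0
  ne_zero : ∀ i < n, α i ≠ 0
  ne_zero' : ∀ i < n, δ i ≠ 0

/-- The coordinates of a vector, extended by zero. -/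
noncomputable def coord (b : Basis (Fin n) F V) (x : V) (k : ℕ) : F :=
  if h : k < n then b.repr x ⟨k, h⟩ else 0

theorem coord_of_le (b : Basis (Fin n) F V) (x : V) {k : ℕ} (hk : n ≤ k) : coord b x k = 0 :=
  dif_neg (by omega)

theorem eq_zero_of_coord {b : Basis (Fin n) F V} {x : V} (h : ∀ k, coord b x k = 0) : x = 0 := by
  refine b.ext_elem fun i => ?_
  have := h i
  rw [coord, dif_pos i.2] at this
  rw [this, map_zero, Finsupp.zero_apply]

theorem sum_ite_mul_repr (b : Basis (Fin n) F V) (x : V) (i k : ℕ) (hi : i ≤ k) (a : F) :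
    ∑ j : Fin n, b.repr x j * (if i + (j : ℕ) = k then a else 0) = a * coord b x (k - i) := by
  rw [coord]
  split_ifs with h
  · rw [Finset.sum_eq_single ⟨k - i, h⟩, if_pos (by simp only; omega), mul_comm]
    · intro j _ hj
      rw [if_neg, mul_zero]
      exact fun h' => hj (Fin.ext (by simp only; omega))
    · exact fun h' => absurd (Finset.mem_univ _) h'
  · rw [mul_zero]
    exact Finset.sum_eq_zero fun j _ => by rw [if_neg (by omega), mul_zero]

namespace AntidiagonalBasis

variable {f : LinearMap.BilinForm F V} {σ : End F V} {c : F} {b : Basis (Fin n) F V}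
  {α β δ : ℕ → F}

theorem apply_basis (H : AntidiagonalBasis f c b α β δ) (i : Fin n) (x : V) :
    f (b i) x = α i * coord b x (n - 1 - i) + β i * coord b x (n - i) := by
  conv_lhs => rw [← b.sum_repr x]
  rw [← sum_ite_mul_repr b x i (n - 1) (by omega), ← sum_ite_mul_repr b x i n (by omega),
    ← Finset.sum_add_distrib, map_sum]
  refine Finset.sum_congr rfl fun j _ => ?_
  rw [map_smul, smul_eq_mul, H.apply_eq, mul_add]
  congr 2
  exact if_congr (by omega) rfl rfl

theorem apply_basis_shift (H : AntidiagonalBasis f c b α β δ) (hσ : IsAsymmetry f σ)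
    (i : Fin n) (x : V) : f (b i) (shift σ c x) = δ i * coord b x (n - i) := by
  rw [hσ.apply_shift, ← sum_ite_mul_repr b x i n (by omega)]
  conv_lhs => rw [← b.sum_repr x]
  rw [map_sum, map_sum, LinearMap.sum_apply, Finset.mul_sum, ← Finset.sum_sub_distrib]
  refine Finset.sum_congr rfl fun j _ => ?_
  rw [← H.apply_sub, map_smul, map_smul, LinearMap.smul_apply, smul_eq_mul, smul_eq_mul]
  ring

/-- A vector is determined by its products with the last basis vectors. -/
theorem coord_eq_zero (H : AntidiagonalBasis f c b α β δ) {x : V} {t : ℕ}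
    (hx : ∀ i : Fin n, (i : ℕ) + t < n → f (b i) x = 0) {k : ℕ} (hk : t ≤ k) :
    coord b x k = 0 := by
  induction h : n - k generalizing k with
  | zero => exact coord_of_le b x (by omega)
  | succ d ih =>
    have h1 := H.apply_basis ⟨n - 1 - k, by omega⟩ x
    rw [hx _ (by simp only; omega)] at h1
    simp only [show n - 1 - (n - 1 - k) = k by omega, show n - (n - 1 - k) = k + 1 by omega] at h1
    rw [ih (k := k + 1) (by omega) (by omega), mul_zero, add_zero, eq_comm] at h1
    exact (mul_eq_zero.mp h1).resolve_left (H.ne_zero _ (by omega))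

theorem nondegenerate (H : AntidiagonalBasis f c b α β δ) : f.Nondegenerate := by
  have := Module.Finite.of_basis b
  refine LinearMap.BilinForm.Nondegenerate.ofSeparatingRight fun x hx => ?_
  exact eq_zero_of_coord fun k => H.coord_eq_zero (t := 0) (fun i _ => hx _) k.zero_le

/-- The shift lowers the highest nonzero coordinate by exactly one place, since `α` and `δ` do not
vanish. Starting from the last basis vector, `n - 1` steps end at a nonzero multiple of the first
one, which pairs nontrivially with the last. -/
theorem cyclicVector (H : AntidiagonalBasis f c b α β δ) (hσ : IsAsymmetry f σ) (hn : 0 < n) :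
    CyclicVector f σ c n (b ⟨n - 1, by omega⟩) := by
  set v := b ⟨n - 1, by omega⟩
  have step : ∀ (x : V) (t : ℕ), (∀ k, t ≤ k → coord b x k = 0) →
      ∀ k, t ≤ k + 1 → coord b (shift σ c x) k = 0 := by
    intro x t hx k hk
    refine H.coord_eq_zero (t := t - 1) (fun i hi => ?_) (by omega)
    rw [H.apply_basis_shift hσ, hx _ (by omega), mul_zero]
  have lead : ∀ k < n, coord b ((shift σ c ^ k) v) (n - 1 - k) ≠ 0 ∧
      ∀ j, n - k ≤ j → coord b ((shift σ c ^ k) v) j = 0 := by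
    intro k
    induction k with
    | zero =>
      intro _
      rw [pow_zero, Module.End.one_apply]
      refine ⟨?_, fun j hj => coord_of_le b v (by omega)⟩
      rw [coord, dif_pos (by omega)]
      simp [v]
    | succ k ih =>
      intro hk
      obtain ⟨h1, h2⟩ := ih (by omega)
      have h3 := step _ _ h2
      rw [pow_succ_apply]
      refine ⟨fun h0 => h1 ?_, fun j hj => h3 j (by omega)⟩
      have h4 := H.apply_basis_shift hσ ⟨k + 1, hk⟩ ((shift σ c ^ k) v)
      rw [H.apply_basis] at h4
      simp only at h4
      rw [h0, h3 _ (by omega), mul_zero, mul_zero, add_zero, eq_comm] at h4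
      rw [show n - 1 - k = n - (k + 1) by omega]
      exact (mul_eq_zero.mp h4).resolve_left (H.ne_zero' _ hk)
  obtain ⟨h1, h2⟩ := lead (n - 1) (by omega)
  constructor
  · obtain ⟨l, rfl⟩ : ∃ l, n = l + 1 := ⟨n - 1, by omega⟩
    rw [pow_succ_apply]
    exact eq_zero_of_coord fun k => step _ _ h2 k (by omega)
  · rw [H.apply_basis, h2 (n - (n - 1)) le_rfl, mul_zero, add_zero]
    exact mul_ne_zero (H.ne_zero _ (by simp only; omega)) h1

/-- The value `c = (-1) ^ (n - 1)` is the ratio of transposed entries on the antidiagonal. On the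
next diagonal the ratio is `-c`, so the contributions add up to `±2`. -/
theorem of_Gamma (h2 : (2 : F) ≠ 0) {b : Basis (Fin n) F V}
    (hb : LinearMap.BilinForm.toMatrix b f = Gamma F n) :
    AntidiagonalBasis f ((-1) ^ (n - 1)) b (fun i => (-1) ^ (n - (i + 1)))
      (fun i => (-1) ^ (n - (i + 1))) fun i => -2 * (-1) ^ i := by
  have key : ∀ i j : Fin n, f (b i) (b j) =
      if (i : ℕ) + j + 1 = n ∨ (i : ℕ) + j = n then (-1) ^ (n - ((i : ℕ) + 1)) else 0 :=
    fun i j => by rw [← LinearMap.BilinForm.toMatrix_apply, hb, Gamma, Matrix.of_apply]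
  have sq : ∀ k, (-1 : F) ^ k * (-1) ^ k = 1 := fun k => by rw [← mul_pow]; simp
  refine ⟨fun i j => ?_, fun ⟨i, hi⟩ ⟨j, hj⟩ => ?_, fun i _ => pow_ne_zero _ (by simp),
    fun i _ => mul_ne_zero (neg_ne_zero.mpr h2) (pow_ne_zero _ (by simp))⟩
  · rw [key]
    split_ifs <;> first | omega | simp
  · rw [key, key]
    simp only
    by_cases h : i + j + 1 = n
    · rw [if_pos (Or.inl (by omega)), if_pos (Or.inl h), if_neg (by omega), ← h,
        show i + j + 1 - (j + 1) = i by omega, show i + j + 1 - (i + 1) = j by omega,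
        Nat.add_sub_cancel, pow_add, mul_assoc, sq, mul_one, sub_self]
    · by_cases h' : i + j = n
      · obtain ⟨i, rfl⟩ : ∃ l, i = l + 1 := ⟨i - 1, by omega⟩
        obtain ⟨j, rfl⟩ : ∃ l, j = l + 1 := ⟨j - 1, by omega⟩
        rw [if_pos (Or.inr (by omega)), if_pos (Or.inr h'), if_pos h', ← h',
          show i + 1 + (j + 1) - (j + 1 + 1) = i by omega,
          show i + 1 + (j + 1) - (i + 1 + 1) = j by omega,
          show i + 1 + (j + 1) - 1 = i + j + 1 by omega]
        have := sq j
        rw [pow_succ, pow_add, pow_succ]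
        linear_combination (-1) ^ i * this
      · rw [if_neg (by omega), if_neg (by omega), if_neg h', mul_zero, sub_zero]

/-- For odd `n`, `i + j = n` excludes `i = j`, so exactly one of the two transposed entries is `1`
and their difference is `±1`. -/
theorem of_GammaZero (hn : Odd n) {b : Basis (Fin n) F V}
    (hb : LinearMap.BilinForm.toMatrix b f = GammaZero F n) :
    AntidiagonalBasis f 1 b (fun _ => 1) (fun i => if n < 2 * i then 1 else 0)
      fun i => if n < 2 * i then -1 else 1 := by
  have key : ∀ i j : Fin n, f (b i) (b j) =
      if (i : ℕ) + j + 1 = n ∨ ((i : ℕ) + j = n ∧ j < i) then 1 else 0 :=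
    fun i j => by rw [← LinearMap.BilinForm.toMatrix_apply, hb, GammaZero, Matrix.of_apply]
  have := Nat.odd_iff.mp hn
  refine ⟨fun i j => ?_, fun ⟨i, hi⟩ ⟨j, hj⟩ => ?_, fun i _ => one_ne_zero, fun i _ => ?_⟩
  · rw [key]
    simp only [Fin.lt_def]
    split_ifs <;> first | omega | simp
  · rw [key, key]
    simp only [Fin.lt_def]
    split_ifs <;> first | omega | simp
  · split_ifs <;> simp

end AntidiagonalBasis

end Antidiagonal

end SplitForm

/-! ### Generators of an indecomposable form. -/

namespace SplitForm

open Module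

variable {F V : Type*} [Field F] [AddCommGroup V] [Module F V]
  {f : LinearMap.BilinForm F V} {σ : End F V}

theorem shift_eq_aeval (σ : End F V) (c : F) : shift σ c = aeval σ (X - C c) := by
  rw [map_sub, aeval_X, aeval_C, shift, Algebra.algebraMap_eq_smul_one]

/-- Each shift crosses the form as `f (N_d x) (σ w) = -d * f x (N_{d⁻¹} w)`, and the factors `-c`
and `-c⁻¹` cancel. So the product is self-adjoint up to `σ²`, which makes kernel and range of its
powers orthogonal. -/
theorem IsAsymmetry.apply_shift_mul_shift (hσ : IsAsymmetry f σ) {c : F} (hc : c ≠ 0) (x w : V) :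
    f ((shift σ c * shift σ c⁻¹) x) ((σ * σ) w) = f x ((shift σ c * shift σ c⁻¹) w) := by
  have key : ∀ d : F, d ≠ 0 → ∀ x w, f (shift σ d x) (σ w) = -d * f x (shift σ d⁻¹ w) := by
    intro d hd x w
    rw [shift_apply, shift_apply, map_sub, LinearMap.sub_apply, hσ.isometry, map_smul,
      LinearMap.smul_apply, map_sub, map_smul, smul_eq_mul, smul_eq_mul]
    field_simp
    ring
  have hcomm : shift σ c⁻¹ (σ w) = σ (shift σ c⁻¹ w) := by
    have := pow_shift_comm σ c⁻¹ 1 w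
    simpa using this.symm
  rw [Module.End.mul_apply, Module.End.mul_apply, Module.End.mul_apply, key c hc, hcomm,
    key c⁻¹ (inv_ne_zero hc), inv_inv]
  field_simp

theorem IsAsymmetry.apply_pow_shift_mul_shift (hσ : IsAsymmetry f σ) {c : F} (hc : c ≠ 0) (n : ℕ)
    (x w : V) : f (((shift σ c * shift σ c⁻¹) ^ n) x) (((σ * σ) ^ n) w) =
      f x (((shift σ c * shift σ c⁻¹) ^ n) w) := by
  induction n generalizing x w with
  | zero => rfl
  | succ n ih =>
    have hcomm : Commute ((σ * σ) ^ n) (shift σ c * shift σ c⁻¹) := by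
      have h : ∀ d, Commute (σ * σ) (shift σ d) := fun d =>
        (commute_shift σ d).mul_left (commute_shift σ d)
      exact ((h c).mul_right (h c⁻¹)).pow_left n
    rw [pow_succ_apply, pow_succ_apply, hσ.apply_shift_mul_shift hc]
    have := LinearMap.congr_fun hcomm.eq w
    rw [Module.End.mul_apply, Module.End.mul_apply (shift σ c * shift σ c⁻¹)] at this
    rw [← this, ih, ← pow_succ_apply']

/-- On an indecomposable space, every vector is killed by a power of `(σ - c) (σ - c⁻¹)`, where
`c` is an eigenvalue of the asymmetry. -/
theorem Indecomposable.exists_pow_eq_zero [FiniteDimensional F V] (hind : Indecomposable f)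
    (hσ : IsAsymmetry f σ) (hf : f.Nondegenerate) {c : F} (hc : c ≠ 0) {v : V} (hv : v ≠ 0)
    (hcv : shift σ c v = 0) :
    ∃ n, 0 < n ∧ (shift σ c * shift σ c⁻¹) ^ n = 0 := by
  set T := shift σ c * shift σ c⁻¹ with hT
  obtain ⟨n, hcompl, hn⟩ := (T.eventually_isCompl_ker_pow_range_pow.and
    (Filter.eventually_gt_atTop 0)).exists
  refine ⟨n, hn, ?_⟩
  have hcomm : Commute σ (T ^ n) :=
    ((commute_shift σ c).mul_right (commute_shift σ c⁻¹)).pow_right n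
  have hinv : ∀ p ∈ LinearMap.ker (T ^ n), σ p ∈ LinearMap.ker (T ^ n) := by
    intro p hp
    rw [LinearMap.mem_ker] at hp ⊢
    rw [← Module.End.mul_apply, ← hcomm.eq, Module.End.mul_apply, hp, map_zero]
  have hinv2 : ∀ k, ∀ p ∈ LinearMap.ker (T ^ n), ((σ * σ) ^ k) p ∈ LinearMap.ker (T ^ n) := by
    intro k p hp
    induction k with
    | zero => exact hp
    | succ k ih =>
      rw [pow_succ_apply]
      exact hinv _ (hinv _ ih)
  have hinj : Function.Injective ((σ * σ) ^ n) := by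
    rw [Module.End.coe_pow]
    exact ((hσ.injective hf).comp (hσ.injective hf)).iterate n
  have htop := (hind.eq_bot_or_eq_top hσ hf hinv fun p hp hx => ?_).resolve_left fun hbot => ?_
  · exact LinearMap.ker_eq_top.mp htop
  · refine hf.2 p fun y => ?_
    obtain ⟨y₁, hy₁, _, ⟨z, rfl⟩, rfl⟩ := Submodule.mem_sup.mp
      (hcompl.sup_eq_top ▸ Submodule.mem_top : y ∈ _ ⊔ _)
    -- Writing `p = σ ^ (2n) q` with `q` in the kernel shows that `p` is orthogonal to the range
    -- too, so a radical vector of the kernel lies in the radical of `f`.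
    obtain ⟨q, hq, rfl⟩ := exists_mem_apply_eq hinj (hinv2 n) hp
    rw [map_add, LinearMap.add_apply, hx y₁ hy₁, zero_add, hσ.apply_pow_shift_mul_shift hc,
      LinearMap.mem_ker.mp hq, map_zero]
  · refine hv ((Submodule.mem_bot F).mp (hbot ▸ LinearMap.mem_ker.mpr ?_))
    obtain ⟨k, rfl⟩ : ∃ k, n = k + 1 := ⟨n - 1, by omega⟩
    rw [pow_succ_apply', hT, (commute_shift_shift σ c c⁻¹).eq, Module.End.mul_apply, hcv, map_zero,
      map_zero]

/-- Vectors killed by a power of `(σ - c) (σ - c⁻¹)` decompose, if `c ≠ c⁻¹`. -/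
theorem exists_add_eq {c : F} (hc : c ≠ c⁻¹) {n : ℕ}
    (h : (shift σ c * shift σ c⁻¹) ^ n = 0) (x : V) :
    ∃ y z, (shift σ c ^ n) y = 0 ∧ (shift σ c⁻¹ ^ n) z = 0 ∧ y + z = x := by
  have hcop : IsCoprime ((X - C c) ^ n) ((X - C c⁻¹) ^ n) :=
    (isCoprime_X_sub_C_of_isUnit_sub (sub_ne_zero.mpr hc).isUnit).pow
  have hx : x ∈ LinearMap.ker (aeval σ ((X - C c) ^ n * (X - C c⁻¹) ^ n)) := by
    rw [LinearMap.mem_ker, ← mul_pow, map_pow, map_mul, ← shift_eq_aeval, ← shift_eq_aeval, h,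
      LinearMap.zero_apply]
  rw [← sup_ker_aeval_eq_ker_aeval_mul_of_coprime σ hcop] at hx
  obtain ⟨y, hy, z, hz, hyz⟩ := Submodule.mem_sup.mp hx
  rw [LinearMap.mem_ker, map_pow, ← shift_eq_aeval] at hy hz
  exact ⟨y, z, hy, hz, hyz⟩

/-- An indecomposable form is generated by a cyclic vector or by a hyperbolic pair. -/
theorem Indecomposable.exists_generators [FiniteDimensional F V] (hF : QuadraticallyClosed F)
    (hind : Indecomposable f) (hσ : IsAsymmetry f σ) (hf : f.Nondegenerate) {c : F} (hc : c ≠ 0)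
    {v : V} (hv : v ≠ 0) (hcv : shift σ c v = 0) :
    (∃ m x, c * c = 1 ∧ NormalizingSign c m ∧ c * (-1) ^ (m - 1) = 1 ∧ CyclicVector f σ c m x) ∨
      ∃ m u w, (c * c = 1 → c * (-1) ^ (m - 1) = -1) ∧ HyperbolicPair f σ c m u w := by
  obtain ⟨n, hn, hTn⟩ := hind.exists_pow_eq_zero hσ hf hc hv hcv
  -- The exponent `2n` serves both cases: when `c = c⁻¹`, the `n`-th power of the product is the
  -- `2n`-th power of one shift.
  have hex : ∃ m, ∀ x, (shift σ c ^ (2 * n)) x = 0 → (shift σ c ^ m) x = 0 := ⟨2 * n, fun _ => id⟩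
  classical
  obtain ⟨m, hm, hmin⟩ : ∃ m, (∀ x, (shift σ c ^ (2 * n)) x = 0 → (shift σ c ^ m) x = 0) ∧
      ∀ k < m, ¬ ∀ x, (shift σ c ^ (2 * n)) x = 0 → (shift σ c ^ k) x = 0 :=
    ⟨Nat.find hex, Nat.find_spec hex, fun k hk => Nat.find_min hex hk⟩
  have hm0 : 0 < m := by
    rcases Nat.eq_zero_or_pos m with rfl | h
    · refine absurd (hm v ?_) hv
      exact pow_apply_eq_zero_of_le (m := 1) (by rw [pow_one, hcv]) (by omega)
    · exact h
  obtain ⟨u, hu⟩ := not_forall.mp (hmin (m - 1) (by omega))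
  obtain ⟨hu0, hu1⟩ := Classical.not_imp.mp hu
  have hum := hm u hu0
  obtain ⟨y, hy⟩ : ∃ y, f y ((shift σ c ^ (m - 1)) u) ≠ 0 := by
    by_contra! h
    exact hu1 (hf.2 _ h)
  obtain ⟨w, hw, hwu⟩ : ∃ w, (shift σ c⁻¹ ^ m) w = 0 ∧ f w ((shift σ c ^ (m - 1)) u) ≠ 0 := by
    by_cases hcc : c * c = 1
    · have hc' := eq_inv_of_mul_eq_one_left hcc
      refine ⟨y, ?_, hy⟩
      rw [← hc']
      refine hm y ?_
      rw [← hc'] at hTn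
      rw [pow_mul, pow_two, hTn, LinearMap.zero_apply]
    · have hne : c ≠ c⁻¹ := fun h => hcc (by nth_rewrite 2 [h]; exact mul_inv_cancel₀ hc)
      have hcc' : c⁻¹ * c⁻¹ ≠ 1 := fun h => hcc (by
        rw [← mul_inv, inv_eq_one] at h
        exact h)
      obtain ⟨y₁, y₂, h1, h2, rfl⟩ := exists_add_eq hne hTn y
      -- Duality transfers the exponent `m` to the eigenvalue `c⁻¹`: the `m`-th power on `y₂` is
      -- orthogonal to both generalized eigenspaces.
      refine ⟨y₂, hf.1 _ fun x => ?_, ?_⟩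
      · obtain ⟨x₁, x₂, g1, g2, rfl⟩ := exists_add_eq hne hTn x
        have h3 : (shift σ c⁻¹ ^ n) ((shift σ c⁻¹ ^ m) y₂) = 0 := by
          rw [pow_add_apply, pow_apply_eq_zero_of_le h2 (by omega)]
        have h4 := hm x₁ (pow_apply_eq_zero_of_le g1 (by omega))
        have h5 := hσ.apply_pow_eq_zero hc h4 y₂ (a := m) (b := 0) (by omega)
        rw [pow_zero, Module.End.one_apply] at h5
        rw [map_add, h5, hσ.apply_eq_zero_of_mul_ne_one hcc' h3 g2, add_zero]
      · have h3 : (shift σ c ^ m) ((shift σ c ^ (m - 1)) u) = 0 := by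
          rw [pow_add_apply, pow_apply_eq_zero_of_le hum (by omega)]
        rwa [map_add, LinearMap.add_apply, hσ.apply_eq_zero_of_mul_ne_one hcc h1 h3,
          zero_add] at hy
  by_cases hcc : c * c = 1
  · have hc' := eq_inv_of_mul_eq_one_left hcc
    rw [← hc'] at hTn
    have hall : ∀ x, (shift σ c ^ m) x = 0 := fun x => hm x (by
      rw [pow_mul, pow_two, hTn, LinearMap.zero_apply])
    by_cases halt : ∀ x, f x ((shift σ c ^ (m - 1)) x) = 0
    · right
      obtain ⟨u', w', h, -⟩ := hσ.exists_hyperbolicPair hF hc (fun _ x _ => halt x) hum hw hwu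
      refine ⟨m, u', w', fun _ => ?_, h⟩
      -- Polarizing the alternating top pairing determines its sign, also in characteristic two.
      have h1 := halt (u + w)
      rw [map_add, map_add, map_add, LinearMap.add_apply, LinearMap.add_apply, halt u, halt w,
        hσ.apply_pow_swap' hcc hm0 (hall u) (hall w)] at h1
      have h2 : (c * (-1) ^ (m - 1) + 1) * f w ((shift σ c ^ (m - 1)) u) = 0 := by
        linear_combination h1
      exact eq_neg_of_add_eq_zero_left ((mul_eq_zero.mp h2).resolve_right hwu)
    · left
      push Not at halt
      obtain ⟨x, hx⟩ := halt
      have hsign : c * (-1) ^ (m - 1) = 1 := by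
        have h := hσ.apply_pow_swap' hcc hm0 (hall x) (hall x)
        have h2 : (c * (-1) ^ (m - 1) - 1) * f x ((shift σ c ^ (m - 1)) x) = 0 := by
          linear_combination -h
        exact sub_eq_zero.mp ((mul_eq_zero.mp h2).resolve_right hx)
      refine ⟨m, x, hcc, ?_, hsign, hall x, hx⟩
      by_cases h2 : (2 : F) = 0
      · have hc1 : c = 1 := by
          rcases mul_self_eq_one_iff.mp hcc with h | h
          · exact h
          · rw [h]
            linear_combination -h2
        refine Or.inr ⟨by rw [hc1]; linear_combination h2, Or.inl ?_⟩
        by_contra hodd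
        have h := hσ.apply_middle hcc hm0 (hall x)
        rw [if_neg hodd, sub_eq_zero.mpr hc1.symm, zero_mul, eq_comm] at h
        exact (mul_ne_zero (pow_ne_zero _ (by simp)) hx) h
      · rcases mul_self_eq_one_iff.mp hcc with h | h
        · refine Or.inl ⟨h, h2, ?_⟩
          rw [h, one_mul] at hsign
          by_contra hodd
          rw [Odd.neg_one_pow (by have := Nat.not_odd_iff.mp hodd; rw [Nat.odd_iff]; omega)] at hsign
          exact h2 (by linear_combination -hsign)
        · exact Or.inr ⟨h, Or.inr h2⟩
  · right
    obtain ⟨u', w', h, -⟩ := hσ.exists_hyperbolicPair hF hc (fun h => absurd h hcc) hum hw hwu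
    exact ⟨m, u', w', fun h => absurd h hcc, h⟩

end SplitForm

/-! ### Elementary divisors and spectrum of a generated form. -/

namespace SplitForm

open Module

theorem natDegree_X_sub_C_pow_eq {F : Type*} [Field F] (c : F) (m : ℕ) :
    ((X - C c) ^ m).natDegree = m := by
  rw [natDegree_pow, natDegree_X_sub_C, mul_one]

section ElementaryDivisors

variable {F V : Type*} [Field F] [AddCommGroup V] [Module F V] {σ : End F V}

/-- The only subspace stable under `σ` which contains all `x i` is the whole space. -/
def Generates {ι : Type*} (σ : End F V) (x : ι → V) : Prop :=
  ∀ P : Submodule F V, (∀ p ∈ P, σ p ∈ P) → (∀ i, x i ∈ P) → P = ⊤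

theorem Generates.aeval_eq_zero {ι : Type*} {x : ι → V} (h : Generates σ x) {p : F[X]}
    (hp : ∀ i, aeval σ p (x i) = 0) : aeval σ p = 0 := by
  refine LinearMap.ker_eq_top.mp (h _ (fun v hv => ?_) hp)
  have hcomm : Commute σ (aeval σ p) := by
    have := (Commute.all X p).map (aeval σ)
    rwa [aeval_X] at this
  rw [LinearMap.mem_ker] at hv ⊢
  rw [← Module.End.mul_apply, ← hcomm.eq, Module.End.mul_apply, hv, map_zero]

/-- Generators of `V` under `σ`, killed by polynomials whose degrees sum up to the dimension of
`V`, yield a decomposition of `V` into cyclic modules. -/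
theorem nonempty_linearEquiv_of_generators [FiniteDimensional F V] {ι : Type} [Fintype ι]
    [DecidableEq ι]
    (q : ι → F[X]) (hq : ∀ i, q i ≠ 0) (x : ι → V) (hx : ∀ i, aeval σ (q i) (x i) = 0)
    (hgen : Generates σ x)
    (hdim : finrank F V = ∑ i, (q i).natDegree) :
    Nonempty (AEval' σ ≃ₗ[F[X]] ((i : ι) → F[X] ⧸ Ideal.span {q i})) := by
  have hker : ∀ i, Ideal.span {q i} ≤
      LinearMap.ker (LinearMap.toSpanSingleton F[X] (AEval' σ) (AEval'.of σ (x i))) := by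
    intro i
    rw [Ideal.span_le, Set.singleton_subset_iff, SetLike.mem_coe, LinearMap.mem_ker,
      LinearMap.toSpanSingleton_apply, ← AEval.of_aeval_smul]
    exact (congrArg _ (hx i)).trans (map_zero _)
  let φ : ((i : ι) → F[X] ⧸ Ideal.span {q i}) →ₗ[F[X]] AEval' σ :=
    LinearMap.lsum F[X] _ ℕ fun i => (Ideal.span {q i}).liftQ
      (LinearMap.toSpanSingleton F[X] (AEval' σ) (AEval'.of σ (x i))) (hker i)
  have hsurj : Function.Surjective φ := by
    let P : Submodule F V :=
      ((LinearMap.range φ).restrictScalars F).comap (AEval'.of σ).toLinearMap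
    have hP : P = ⊤ := by
      refine hgen P (fun p hp => ?_) fun i => ?_
      · have : (X : F[X]) • AEval'.of σ p ∈ LinearMap.range φ := Submodule.smul_mem _ _ hp
        rw [AEval'.X_smul_of] at this
        exact this
      · refine ⟨Pi.single i (Submodule.Quotient.mk 1), ?_⟩
        simp only [φ, LinearMap.lsum_piSingle]
        rw [Submodule.liftQ_apply, LinearMap.toSpanSingleton_apply, one_smul]
        rfl
    intro y
    obtain ⟨v, rfl⟩ := (AEval'.of σ).surjective y
    have : v ∈ P := hP ▸ Submodule.mem_top
    exact this
  have hfin : ∀ i, FiniteDimensional F (F[X] ⧸ Ideal.span {q i}) := fun i =>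
    (AdjoinRoot.powerBasis (hq i)).finite
  have hrank : finrank F ((i : ι) → F[X] ⧸ Ideal.span {q i}) = finrank F (AEval' σ) := by
    rw [← (AEval'.of σ).finrank_eq, hdim, finrank_pi_fintype]
    exact Finset.sum_congr rfl fun i _ => finrank_quotient_span_eq_natDegree
  have : FiniteDimensional F (AEval' σ) := (AEval'.of σ).finiteDimensional
  -- The sum of cyclic modules surjects onto `V`, and the degree condition makes the dimensions
  -- agree.
  have hinj : Function.Injective φ :=
    (LinearMap.injective_iff_surjective_of_finrank_eq_finrank (f := φ.restrictScalars F) hrank).mpr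
      hsurj
  exact ⟨(LinearEquiv.ofBijective φ ⟨hinj, hsurj⟩).symm⟩

end ElementaryDivisors

section Generated

variable {F V : Type*} [Field F] [AddCommGroup V] [Module F V]

/-- `V` is generated by a cyclic vector or by a hyperbolic pair; the list consists of the
elementary divisors of the asymmetry. -/
inductive GeneratedBy (f : LinearMap.BilinForm F V) (σ : End F V) (c : F) : List F[X] → Prop
  | cyclic {m : ℕ} {v : V} (hc : c * c = 1) (hv : CyclicVector f σ c m v)
      (hm : finrank F V = m) : GeneratedBy f σ c [(X - C c) ^ m]
  | hyperbolic {m : ℕ} {u w : V} (hc : c ≠ 0) (hsign : c * c = 1 → c * (-1) ^ (m - 1) = -1)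
      (h : HyperbolicPair f σ c m u w) (hm : finrank F V = m + m) :
      GeneratedBy f σ c [(X - C c) ^ m, (X - C c⁻¹) ^ m]

variable {f : LinearMap.BilinForm F V} {σ : End F V} {c : F} {m : ℕ}

theorem CyclicVector.generates [FiniteDimensional F V]
    {v : V} (h : CyclicVector f σ c m v) (hσ : IsAsymmetry f σ)
    (hc : c * c = 1) (hm : finrank F V = m) : Generates σ ![v] := by
  intro P hP hv
  rw [eq_top_iff, ← h.span_eq_top hσ hc hm, Submodule.span_le]
  rintro _ ⟨i, rfl⟩
  exact shift_pow_mem hP c _ (hv 0)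

theorem HyperbolicPair.generates [FiniteDimensional F V]
    {u w : V} (h : HyperbolicPair f σ c m u w)
    (hσ : IsAsymmetry f σ) (hc : c ≠ 0) (hm : finrank F V = m + m) : Generates σ ![u, w] := by
  intro P hP hv
  rw [eq_top_iff, ← h.span_eq_top hσ hc hm, Submodule.span_le]
  rintro _ ⟨i | i, rfl⟩
  · exact shift_pow_mem hP c _ (hv 0)
  · exact shift_pow_mem hP c⁻¹ _ (hv 1)

namespace GeneratedBy

variable {q : List F[X]}

theorem ne_zero (h : GeneratedBy f σ c q) : c ≠ 0 := by
  cases h with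
  | cyclic hc => exact left_ne_zero_of_mul_eq_one hc
  | hyperbolic hc => exact hc

theorem indecomposable [FiniteDimensional F V]
    (h : GeneratedBy f σ c q) (hF : QuadraticallyClosed F)
    (hσ : IsAsymmetry f σ) (hf : f.Nondegenerate) : Indecomposable f := by
  cases h with
  | cyclic hc hv hm => exact hv.indecomposable hσ hf hc hm
  | hyperbolic hc hsign h hm => exact h.indecomposable hF hσ hf hc hm hsign

theorem hasElementaryDivisors [FiniteDimensional F V]
    (h : GeneratedBy f σ c q) (hσ : IsAsymmetry f σ) :
    HasElementaryDivisors σ q := by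
  cases h with
  | @cyclic m v hc hv hm =>
    refine ⟨fun r hr => ⟨X - C c, m, monic_X_sub_C c, irreducible_X_sub_C c, hv.pos,
      List.mem_singleton.mp hr⟩, ?_⟩
    refine nonempty_linearEquiv_of_generators (ι := Fin 1) (fun i => [(X - C c) ^ m].get i)
      (fun i => ?_) ![v] (fun i => ?_) (hv.generates hσ hc hm) ?_
    · fin_cases i
      exact pow_ne_zero _ (X_sub_C_ne_zero c)
    · fin_cases i
      have := hv.pow_eq_zero
      rw [shift_eq_aeval, ← map_pow] at this
      exact this
    · rw [Fin.sum_univ_one, hm]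
      exact (natDegree_X_sub_C_pow_eq c m).symm
  | @hyperbolic m u w hc hsign h hm =>
    refine ⟨fun r hr => ?_, ?_⟩
    · rcases List.mem_pair.mp hr with rfl | rfl
      · exact ⟨X - C c, m, monic_X_sub_C c, irreducible_X_sub_C c, h.pos, rfl⟩
      · exact ⟨X - C c⁻¹, m, monic_X_sub_C _, irreducible_X_sub_C _, h.pos, rfl⟩
    · refine nonempty_linearEquiv_of_generators (ι := Fin 2)
        (fun i => [(X - C c) ^ m, (X - C c⁻¹) ^ m].get i)
        (fun i => ?_) ![u, w] (fun i => ?_) (h.generates hσ hc hm) ?_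
      · fin_cases i
        · exact pow_ne_zero _ (X_sub_C_ne_zero c)
        · exact pow_ne_zero _ (X_sub_C_ne_zero c⁻¹)
      · have h1 := h.pow_left
        have h2 := h.pow_right
        rw [shift_eq_aeval, ← map_pow] at h1 h2
        fin_cases i
        · exact h1
        · exact h2
      · rw [Fin.sum_univ_two, hm]
        exact congrArg₂ (· + ·) (natDegree_X_sub_C_pow_eq c m).symm (natDegree_X_sub_C_pow_eq c⁻¹ m).symm

theorem exists_aeval_eq_zero [FiniteDimensional F V]
    (h : GeneratedBy f σ c q) (hσ : IsAsymmetry f σ) :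
    ∃ m : ℕ, aeval σ ((X - C c) ^ m * (X - C c⁻¹) ^ m) = 0 := by
  cases h with
  | @cyclic m v hc hv hm =>
    refine ⟨m, (hv.generates hσ hc hm).aeval_eq_zero fun i => ?_⟩
    have := hv.pow_eq_zero
    rw [shift_eq_aeval, ← map_pow] at this
    fin_cases i
    rw [mul_comm, map_mul, Module.End.mul_apply]
    exact (congrArg _ this).trans (map_zero _)
  | @hyperbolic m u w hc hsign h hm =>
    refine ⟨m, (h.generates hσ hc hm).aeval_eq_zero fun i => ?_⟩
    have h1 := h.pow_left
    have h2 := h.pow_right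
    rw [shift_eq_aeval, ← map_pow] at h1 h2
    fin_cases i
    · rw [mul_comm, map_mul, Module.End.mul_apply]
      exact (congrArg _ h1).trans (map_zero _)
    · rw [map_mul, Module.End.mul_apply]
      exact (congrArg _ h2).trans (map_zero _)

theorem splits [FiniteDimensional F V]
    (h : GeneratedBy f σ c q) (hσ : IsAsymmetry f σ) : (minpoly F σ).Splits := by
  obtain ⟨m, hm⟩ := h.exists_aeval_eq_zero hσ
  refine Splits.of_dvd (((Splits.X_sub_C c).pow m).mul ((Splits.X_sub_C c⁻¹).pow m)) ?_
    (minpoly.dvd F σ hm)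
  exact mul_ne_zero (pow_ne_zero _ (X_sub_C_ne_zero _)) (pow_ne_zero _ (X_sub_C_ne_zero _))

theorem hasEigenvalue (h : GeneratedBy f σ c q) : σ.HasEigenvalue c := by
  have key : ∀ {m : ℕ} {v x : V}, 0 < m → (shift σ c ^ m) v = 0 →
      f x ((shift σ c ^ (m - 1)) v) ≠ 0 → σ.HasEigenvalue c := by
    intro m v x hm hv hx
    refine Module.End.hasEigenvalue_of_hasEigenvector (x := (shift σ c ^ (m - 1)) v) ⟨?_, ?_⟩
    · rw [Module.End.mem_eigenspace_iff, ← sub_eq_zero, ← shift_apply, ← pow_succ_apply,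
        Nat.sub_add_cancel hm, hv]
    · intro h0
      rw [h0, map_zero] at hx
      exact hx rfl
  cases h with
  | cyclic hc hv hm => exact key hv.pos hv.pow_eq_zero hv.pairing
  | hyperbolic hc hsign h hm => exact key h.pos h.pow_left h.pairing

theorem eq_or_eq_inv_of_hasEigenvalue [FiniteDimensional F V]
    (h : GeneratedBy f σ c q) (hσ : IsAsymmetry f σ) {d : F}
    (hd : σ.HasEigenvalue d) : d = c ∨ d = c⁻¹ := by
  obtain ⟨m, hm⟩ := h.exists_aeval_eq_zero hσ
  obtain ⟨x, hx⟩ := hd.exists_hasEigenvector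
  have h1 := Module.End.aeval_apply_of_hasEigenvector hx
    (p := (X - C c) ^ m * (X - C c⁻¹) ^ m)
  rw [hm, LinearMap.zero_apply, eq_comm] at h1
  have h2 := (smul_eq_zero.mp h1).resolve_right hx.2
  simp only [eval_mul, eval_pow, eval_sub, eval_X, eval_C] at h2
  exact (mul_eq_zero.mp h2).imp (fun h => sub_eq_zero.mp (eq_zero_of_pow_eq_zero h))
    fun h => sub_eq_zero.mp (eq_zero_of_pow_eq_zero h)

/-- With `pow_eq_zero_of_length`, this separates `C` from `F`: one Jordan block of full size against
two blocks of half the size. -/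
theorem pow_ne_zero_of_length (h : GeneratedBy f σ c q) (hq : q.length = 1) :
    shift σ c ^ (finrank F V - 1) ≠ 0 := by
  cases h with
  | cyclic hc hv hm =>
    intro h0
    refine hv.pairing ?_
    rw [← hm, h0, LinearMap.zero_apply, map_zero]
  | hyperbolic => simp at hq

theorem pow_eq_zero_of_length [FiniteDimensional F V]
    (h : GeneratedBy f σ c q) (hσ : IsAsymmetry f σ) (hc : c * c = 1)
    (hq : q.length = 2) : shift σ c ^ (finrank F V - 1) = 0 := by
  cases h with
  | cyclic => simp at hq
  | @hyperbolic m u w hc0 hsign h hm =>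
    have hpos := h.pos
    have h1 := h.pow_left
    have h2 := h.pow_right
    rw [← eq_inv_of_mul_eq_one_left hc] at h2
    rw [shift_eq_aeval, ← map_pow]
    refine (h.generates hσ hc0 hm).aeval_eq_zero fun i => ?_
    rw [map_pow, ← shift_eq_aeval]
    fin_cases i
    · exact pow_apply_eq_zero_of_le h1 (by omega)
    · exact pow_apply_eq_zero_of_le h2 (by omega)

end GeneratedBy

end Generated

end SplitForm

/-! ### Passage between normal forms and generators. -/

namespace SplitForm

open Module

theorem ringChar_eq_two_iff {F : Type*} [Field F] : ringChar F = 2 ↔ (2 : F) = 0 := by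
  rw [show (2 : F) = ((2 : ℕ) : F) by norm_cast, ringChar.spec]
  constructor
  · exact fun h => h ▸ dvd_rfl
  · exact fun h => ((Nat.dvd_prime Nat.prime_two).mp h).resolve_left CharP.ringChar_ne_one

variable {F V : Type*} [Field F] [AddCommGroup V] [Module F V]

namespace NormalForm

/-- An eigenvalue of the asymmetry of the forms represented by the matrix. -/
def eigenvalue : NormalForm F → F
  | typeA _ => 1
  | typeB _ => 1
  | typeC _ => -1
  | typeD _ => 1
  | typeE _ => 1
  | typeF _ => -1
  | typeG _ c => c

end NormalForm

section Existence

variable {f : LinearMap.BilinForm F V} {σ : End F V}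

theorem AdmitsGram.finrank_eq {t : NormalForm F} (h : AdmitsGram f t) : finrank F V = t.size := by
  obtain ⟨b, -⟩ := h
  rw [finrank_eq_card_basis b, Fintype.card_fin]

theorem generatedBy_of_blockMatrix [FiniteDimensional F V]
    {m : ℕ} {c : F} (hm : 0 < m) (hc : c ≠ 0)
    (hsign : c * c = 1 → c * (-1) ^ (m - 1) = -1) {b : Basis (Fin (m + m)) F V}
    (hb : LinearMap.BilinForm.toMatrix b f = blockMatrix F m c) :
    f.Nondegenerate ∧ ∀ σ, IsAsymmetry f σ →
      GeneratedBy f σ c [(X - C c) ^ m, (X - C c⁻¹) ^ m] := by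
  have hf := nondegenerate_of_blockMatrix hc hb
  have hdim : finrank F V = m + m := by rw [finrank_eq_card_basis b, Fintype.card_fin]
  refine ⟨hf, fun σ hσ => ?_⟩
  obtain ⟨u, w, h⟩ := (BlockFamily.of_basis hb).exists_hyperbolicPair hdim hf hσ hc hm
  exact .hyperbolic hc hsign h hdim

theorem AntidiagonalBasis.generatedBy {n : ℕ} {c : F} {b : Basis (Fin n) F V} {α β δ : ℕ → F}
    (H : AntidiagonalBasis f c b α β δ) (hn : 0 < n) (hc : c * c = 1) :
    f.Nondegenerate ∧ ∀ σ, IsAsymmetry f σ → GeneratedBy f σ c [(X - C c) ^ n] :=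
  ⟨H.nondegenerate, fun _ hσ => .cyclic hc (H.cyclicVector hσ hn)
    (by rw [finrank_eq_card_basis b, Fintype.card_fin])⟩

/-- The admissibility conditions are what the sign conditions need: `c (-1) ^ (m - 1) = -1` for `D`
and `F` by parity of `m`, and for `E` because `1 = -1`. -/
theorem AdmitsGram.generatedBy [FiniteDimensional F V]
    {t : NormalForm F} (ht : t.Admissible) (h : AdmitsGram f t) :
    f.Nondegenerate ∧ ∀ σ, IsAsymmetry f σ →
      GeneratedBy f σ t.eigenvalue t.elementaryDivisors := by
  obtain ⟨b, hb⟩ := h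
  rcases t with n | n | n | m | m | m | ⟨m, c⟩
  · obtain ⟨hodd, h2⟩ := ht
    have H := AntidiagonalBasis.of_Gamma (fun h => h2 (ringChar_eq_two_iff.mpr h)) hb
    have hc : (-1 : F) ^ (n - 1) = 1 := (Nat.Odd.sub_odd hodd odd_one).neg_one_pow
    erw [hc] at H
    have := H.generatedBy hodd.pos (one_mul 1)
    rwa [C_1] at this
  · obtain ⟨hodd, h2⟩ := ht
    have := (AntidiagonalBasis.of_GammaZero hodd hb).generatedBy hodd.pos (one_mul 1)
    rwa [C_1] at this
  · obtain ⟨h0, heven, h2⟩ := ht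
    have H := AntidiagonalBasis.of_Gamma (fun h => h2 (ringChar_eq_two_iff.mpr h)) hb
    have hc : (-1 : F) ^ (n - 1) = -1 :=
      (Nat.Even.sub_odd h0 heven odd_one).neg_one_pow
    erw [hc] at H
    have := H.generatedBy h0 (by ring)
    rwa [C_neg, C_1, sub_neg_eq_add] at this
  · obtain ⟨h0, heven⟩ := ht
    have := generatedBy_of_blockMatrix h0 one_ne_zero (fun _ => by
      rw [(Nat.Even.sub_odd h0 heven odd_one).neg_one_pow, one_mul]) hb
    rwa [inv_one, C_1] at this
  · obtain ⟨hodd, h2⟩ := ht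
    have := generatedBy_of_blockMatrix hodd.pos one_ne_zero (fun _ => by
      rw [(Nat.Odd.sub_odd hodd odd_one).neg_one_pow]
      linear_combination ringChar_eq_two_iff.mp h2) hb
    rwa [inv_one, C_1] at this
  · obtain ⟨hodd, h2⟩ := ht
    have := generatedBy_of_blockMatrix hodd.pos (neg_ne_zero.mpr one_ne_zero) (fun _ => by
      rw [(Nat.Odd.sub_odd hodd odd_one).neg_one_pow, mul_one]) hb
    rwa [inv_neg, inv_one, C_neg, C_1, sub_neg_eq_add] at this
  · obtain ⟨h0, hc, hcc⟩ := ht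
    exact generatedBy_of_blockMatrix h0 hc (fun h => absurd ((sq c).trans h) hcc) hb

/-- The form on `F ^ m` with matrix `M` is also cyclic with the same parameters, hence equivalent to
`f`; the standard basis is carried over. -/
theorem CyclicVector.exists_basis_toMatrix [FiniteDimensional F V]
    (hF : QuadraticallyClosed F) {m : ℕ} {c : F} {v : V}
    (hv : CyclicVector f σ c m v) (hσ : IsAsymmetry f σ) (hc : NormalizingSign c m)
    (hm : finrank F V = m) {M : Matrix (Fin m) (Fin m) F} {α β δ : ℕ → F}
    (hM : AntidiagonalBasis (Matrix.toBilin (Pi.basisFun F (Fin m)) M) c (Pi.basisFun F (Fin m))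
      α β δ) : ∃ b : Basis (Fin m) F V, LinearMap.BilinForm.toMatrix b f = M := by
  have hτ := isAsymmetry_asymmetry _ hM.nondegenerate
  obtain ⟨e⟩ := hv.equivalent hF (hM.cyclicVector hτ hv.pos) hσ hτ hc hm (by simp)
  refine ⟨(Pi.basisFun F (Fin m)).map e.toLinearEquiv.symm, ?_⟩
  ext i j
  have h := LinearMap.BilinForm.toMatrix_toBilin (Pi.basisFun F (Fin m)) M
  rw [LinearMap.BilinForm.toMatrix_apply, ← e.map_app, ← congrFun (congrFun h i) j,
    LinearMap.BilinForm.toMatrix_apply, Basis.map_apply, Basis.map_apply]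
  congr 2 <;> exact e.toLinearEquiv.apply_symm_apply _

theorem CyclicVector.exists_admitsGram [FiniteDimensional F V]
    (hF : QuadraticallyClosed F) {m : ℕ} {c : F} {v : V}
    (hv : CyclicVector f σ c m v) (hσ : IsAsymmetry f σ) (hc : NormalizingSign c m)
    (hsign : c * (-1) ^ (m - 1) = 1) (hm : finrank F V = m) :
    ∃ t : NormalForm F, t.Admissible ∧ AdmitsGram f t := by
  have toMatrix := LinearMap.BilinForm.toMatrix_toBilin (Pi.basisFun F (Fin m))
  by_cases h2 : (2 : F) = 0
  · have hodd : Odd m := by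
      rcases hc with ⟨-, h, -⟩ | ⟨-, h⟩
      · exact absurd h2 h
      · exact h.resolve_right fun h => h h2
    have hc1 : c = 1 := by
      rwa [(Nat.Odd.sub_odd hodd odd_one).neg_one_pow, mul_one] at hsign
    subst hc1
    exact ⟨.typeB m, ⟨hodd, ringChar_eq_two_iff.mpr h2⟩,
      hv.exists_basis_toMatrix hF hσ hc hm (AntidiagonalBasis.of_GammaZero hodd (toMatrix _))⟩
  · have hc' : c = (-1) ^ (m - 1) := by
      have : ((-1 : F) ^ (m - 1)) * (-1) ^ (m - 1) = 1 := by rw [← mul_pow]; simp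
      linear_combination (-1) ^ (m - 1) * hsign - c * this
    have hb : ∃ b : Basis (Fin m) F V, LinearMap.BilinForm.toMatrix b f = Gamma F m := by
      refine hv.exists_basis_toMatrix hF hσ hc hm (α := fun i => (-1) ^ (m - (i + 1)))
        (β := fun i => (-1) ^ (m - (i + 1))) (δ := fun i => -2 * (-1) ^ i) ?_
      rw [hc']
      exact AntidiagonalBasis.of_Gamma h2 (toMatrix _)
    have h2' : ringChar F ≠ 2 := fun h => h2 (ringChar_eq_two_iff.mp h)
    rcases Nat.even_or_odd m with heven | hodd
    · exact ⟨.typeC m, ⟨hv.pos, heven, h2'⟩, hb⟩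
    · exact ⟨.typeA m, ⟨hodd, h2'⟩, hb⟩

theorem HyperbolicPair.exists_admitsGram [FiniteDimensional F V]
    {m : ℕ} {c : F} {u w : V}
    (h : HyperbolicPair f σ c m u w) (hσ : IsAsymmetry f σ) (hc : c ≠ 0)
    (hsign : c * c = 1 → c * (-1) ^ (m - 1) = -1) (hm : finrank F V = m + m) :
    ∃ t : NormalForm F, t.Admissible ∧ AdmitsGram f t := by
  have hb := h.exists_basis hσ hc hm
  have hpos := h.pos
  by_cases hcc : c * c = 1
  · specialize hsign hcc
    rcases Nat.even_or_odd m with heven | hodd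
    · obtain rfl : c = 1 := by
        rw [(Nat.Even.sub_odd hpos heven odd_one).neg_one_pow] at hsign
        linear_combination -hsign
      exact ⟨.typeD m, ⟨hpos, heven⟩, hb⟩
    · obtain rfl : c = -1 := by
        rwa [(Nat.Odd.sub_odd hodd odd_one).neg_one_pow, mul_one] at hsign
      by_cases h2 : ringChar F = 2
      · rw [show (-1 : F) = 1 by linear_combination -ringChar_eq_two_iff.mp h2] at hb
        exact ⟨.typeE m, ⟨hodd, h2⟩, hb⟩
      · exact ⟨.typeF m, ⟨hodd, h2⟩, hb⟩
  · exact ⟨.typeG m c, ⟨hpos, hc, fun h => hcc ((sq c).symm.trans h)⟩, hb⟩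

theorem Indecomposable.exists_admitsGram [FiniteDimensional F V]
    [Nontrivial V] (hF : QuadraticallyClosed F)
    (hf : f.Nondegenerate) (hind : Indecomposable f) (hs : Split f hf) :
    ∃ t : NormalForm F, t.Admissible ∧ AdmitsGram f t := by
  have hσ := isAsymmetry_asymmetry f hf
  obtain ⟨c, hroot⟩ := Splits.exists_eval_eq_zero hs
    (minpoly.degree_pos (Algebra.IsIntegral.isIntegral _)).ne'
  obtain ⟨v, hv⟩ := (Module.End.hasEigenvalue_of_isRoot hroot).exists_hasEigenvector
  have hv0 := hv.2
  have hcv := hv.apply_eq_smul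
  have hc : c ≠ 0 := by
    rintro rfl
    rw [zero_smul] at hcv
    exact hv0 ((injective_iff_map_eq_zero _).mp (hσ.injective hf) v hcv)
  rcases hind.exists_generators hF hσ hf hc hv0 (by rw [shift_apply, hcv, sub_self]) with
    ⟨m, x, hcc, hn, hsign, hx⟩ | ⟨m, u, w, hsign, h⟩
  · exact hx.exists_admitsGram hF hσ hn hsign (hx.finrank_eq hind hσ hf hcc)
  · exact h.exists_admitsGram hσ hc hsign (h.finrank_eq hind hσ hf hc)

theorem AdmitsGram.equivalent {g : LinearMap.BilinForm F V} {t : NormalForm F}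
    (hs : AdmitsGram f t) (ht : AdmitsGram g t) : f.Equivalent g := by
  obtain ⟨b, hb⟩ := hs
  obtain ⟨b', hb'⟩ := ht
  refine equivalent_of_gram b b' fun i j => ?_
  rw [← LinearMap.BilinForm.toMatrix_apply, ← LinearMap.BilinForm.toMatrix_apply, hb, hb']

/-- Exchanging the two vectors of the hyperbolic pair inverts the eigenvalue. -/
theorem AdmitsGram.typeG_inv [FiniteDimensional F V]
    {m : ℕ} {c : F} (ht : (NormalForm.typeG m c).Admissible)
    (h : AdmitsGram f (.typeG m c)) : AdmitsGram f (.typeG m c⁻¹) := by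
  obtain ⟨b, hb⟩ := h
  obtain ⟨h0, hc, -⟩ := ht
  have hf := nondegenerate_of_blockMatrix hc hb
  have hσ := isAsymmetry_asymmetry f hf
  have hdim : finrank F V = m + m := by rw [finrank_eq_card_basis b]; exact Fintype.card_fin _
  obtain ⟨u, w, h⟩ := (BlockFamily.of_basis hb).exists_hyperbolicPair hdim hf hσ hc h0
  exact (h.symm hσ hc).exists_basis hσ (inv_ne_zero hc) hdim

end Existence

/-! ### Similarity of asymmetries determines the normal form. -/

section Uniqueness

variable {f g : LinearMap.BilinForm F V} {σ τ : End F V}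

theorem hasEigenvalue_of_conj (e : V ≃ₗ[F] V) (he : ∀ x, e (σ x) = τ (e x)) {c : F}
    (hc : σ.HasEigenvalue c) : τ.HasEigenvalue c := by
  obtain ⟨x, hx⟩ := hc.exists_hasEigenvector
  refine Module.End.hasEigenvalue_of_hasEigenvector (x := e x) ⟨?_, ?_⟩
  · rw [Module.End.mem_eigenspace_iff, ← he, hx.apply_eq_smul, map_smul]
  · exact fun h => hx.2 (e.map_eq_zero_iff.mp h)

theorem shift_pow_eq_zero_of_conj (e : V ≃ₗ[F] V) (he : ∀ x, e (σ x) = τ (e x)) {c : F} {k : ℕ}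
    (h : shift σ c ^ k = 0) : shift τ c ^ k = 0 := by
  have key : ∀ x, e ((shift σ c ^ k) x) = (shift τ c ^ k) (e x) := by
    intro x
    clear h
    induction k with
    | zero => rfl
    | succ k ih =>
      rw [pow_succ_apply, pow_succ_apply, ← ih, shift_apply, shift_apply, map_sub, he, map_smul]
  ext x
  rw [← e.apply_symm_apply x, ← key, h, LinearMap.zero_apply, map_zero, LinearMap.zero_apply]

/-- The matrix in the list is determined by the similarity class of the asymmetry, up to
inverting the parameter. -/
theorem NormalForm.eq_or_inv_of_conj [FiniteDimensional F V] (hσ : IsAsymmetry f σ)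
    (hτ : IsAsymmetry g τ)
    (e : V ≃ₗ[F] V) (he : ∀ x, e (σ x) = τ (e x)) {s t : NormalForm F} (hs : s.Admissible)
    (ht : t.Admissible) (hfs : AdmitsGram f s) (hgt : AdmitsGram g t) :
    s = t ∨ ∃ (m : ℕ) (c : F), s = .typeG m c ∧ t = .typeG m c⁻¹ := by
  have hf := (hfs.generatedBy hs).2 σ hσ
  have hg := (hgt.generatedBy ht).2 τ hτ
  have hsize : s.size = t.size := hfs.finrank_eq.symm.trans hgt.finrank_eq
  have heig := hg.eq_or_eq_inv_of_hasEigenvalue hτ (hasEigenvalue_of_conj e he hf.hasEigenvalue)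
  have he' : ∀ x, e.symm (τ x) = σ (e.symm x) := fun x => by
    rw [LinearEquiv.symm_apply_eq, he, LinearEquiv.apply_symm_apply]
  have hneg : (-1 : F) = 1 ↔ (2 : F) = 0 :=
    ⟨fun h => by linear_combination -h, fun h => by linear_combination -h⟩
  have hneg' : (1 : F) = -1 ↔ (2 : F) = 0 := by rw [eq_comm, hneg]
  have hCF : ∀ (n m : ℕ), s = .typeC n → t = .typeF m → False := by
    rintro n m rfl rfl
    exact hf.pow_ne_zero_of_length rfl (shift_pow_eq_zero_of_conj e.symm he'
      (hg.pow_eq_zero_of_length hτ (by simp [eigenvalue]) rfl))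
  have hFC : ∀ (n m : ℕ), s = .typeF m → t = .typeC n → False := by
    rintro n m rfl rfl
    exact hg.pow_ne_zero_of_length rfl (shift_pow_eq_zero_of_conj e he
      (hf.pow_eq_zero_of_length hσ (by simp [eigenvalue]) rfl))
  clear hf hg hfs hgt
  -- Characteristic, eigenvalue and size modulo `4` exclude all pairs of distinct types except `C`
  -- and `F`, handled by `hCF` and `hFC`; only the pair of types `G` is left over.
  cases s <;> cases t <;>
    simp only [Admissible, size, eigenvalue, ringChar_eq_two_iff, inv_neg, inv_one, or_self, hneg,
      hneg', Nat.odd_iff, Nat.even_iff, ne_eq] at hs ht hsize heig <;>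
    first
    | (exfalso; omega)
    | (left; congr 1 <;> omega)
    | (exfalso; grind)
    | skip
  rename_i m₁ c₁ m₂ c₂
  obtain rfl : m₁ = m₂ := by omega
  rcases heig with rfl | rfl
  · exact Or.inl rfl
  · exact Or.inr ⟨_, _, rfl, by rw [inv_inv]⟩

theorem equivalent_of_conj [FiniteDimensional F V] (hσ : IsAsymmetry f σ) (hτ : IsAsymmetry g τ)
    (e : V ≃ₗ[F] V) (he : ∀ x, e (σ x) = τ (e x)) {s t : NormalForm F} (hs : s.Admissible)
    (ht : t.Admissible) (hfs : AdmitsGram f s) (hgt : AdmitsGram g t) : f.Equivalent g := by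
  rcases NormalForm.eq_or_inv_of_conj hσ hτ e he hs ht hfs hgt with rfl | ⟨m, c, rfl, rfl⟩
  · exact hfs.equivalent hgt
  · exact (hfs.typeG_inv hs).equivalent hgt

theorem isConj_asymmetry_iff [FiniteDimensional F V] (hf : f.Nondegenerate)
    (hg : g.Nondegenerate) : IsConj (asymmetry f hf) (asymmetry g hg) ↔
      ∃ e : V ≃ₗ[F] V, ∀ x, e (asymmetry f hf x) = asymmetry g hg (e x) := by
  rw [isConj_iff]
  refine exists_congr fun e => ?_
  rw [mul_inv_eq_iff_eq_mul]
  exact ⟨fun h x => LinearEquiv.congr_fun h x, fun h => LinearEquiv.ext h⟩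

theorem isConj_asymmetry_of_equivalent [FiniteDimensional F V] (hf : f.Nondegenerate)
    (hg : g.Nondegenerate) (h : f.Equivalent g) :
    IsConj (asymmetry f hf) (asymmetry g hg) := by
  obtain ⟨e⟩ := h
  refine (isConj_asymmetry_iff hf hg).mpr ⟨e.toLinearEquiv, fun x => ?_⟩
  refine sub_eq_zero.mp (hg.2 _ fun y => ?_)
  obtain ⟨y, rfl⟩ := e.toLinearEquiv.surjective y
  rw [map_sub, apply_asymmetry, sub_eq_zero]
  exact (e.map_app _ _).trans ((apply_asymmetry f hf y x).trans (e.map_app _ _).symm)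

end Uniqueness

end SplitForm

theorem mainTheorem2 {F V : Type*} [Field F] [AddCommGroup V] [Module F V]
    [FiniteDimensional F V] [Nontrivial V] (hF : SplitForm.QuadraticallyClosed F) :
    -- the equivalence class is determined by the similarity type of the asymmetry
    (∀ (f g : LinearMap.BilinForm F V) (hf : f.Nondegenerate) (hg : g.Nondegenerate),
      SplitForm.Indecomposable f → SplitForm.Split f hf →
      SplitForm.Indecomposable g → SplitForm.Split g hg →
        (f.Equivalent g ↔ IsConj (SplitForm.asymmetry f hf) (SplitForm.asymmetry g hg))) ∧
    -- forms with a Gram matrix from the list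
    (∀ (f : LinearMap.BilinForm F V) (t : SplitForm.NormalForm F),
      t.Admissible → SplitForm.AdmitsGram f t →
        ∃ hf : f.Nondegenerate, SplitForm.Indecomposable f ∧ SplitForm.Split f hf ∧
          SplitForm.HasElementaryDivisors (SplitForm.asymmetry f hf : Module.End F V)
            t.elementaryDivisors) ∧
    -- every form admits a Gram matrix from the list, unique up to inverting the parameter
    (∀ (f : LinearMap.BilinForm F V) (hf : f.Nondegenerate),
      SplitForm.Indecomposable f → SplitForm.Split f hf →
        (∃ t : SplitForm.NormalForm F, t.Admissible ∧ SplitForm.AdmitsGram f t) ∧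
        (∀ s t : SplitForm.NormalForm F, s.Admissible → t.Admissible →
          SplitForm.AdmitsGram f s → SplitForm.AdmitsGram f t →
            s = t ∨ ∃ (m : ℕ) (c : F), s = .typeG m c ∧ t = .typeG m c⁻¹)) ∧
    -- the exception: the parameters `c` and `c⁻¹` represent equivalent forms
    (∀ (m : ℕ) (c : F), (SplitForm.NormalForm.typeG m c).Admissible →
      ∀ f g : LinearMap.BilinForm F V,
        SplitForm.AdmitsGram f (.typeG m c) → SplitForm.AdmitsGram g (.typeG m c⁻¹) →
          f.Equivalent g) := by
  refine ⟨fun f g hf hg hif hsf hig hsg => ⟨?_, fun h => ?_⟩, fun f t ht hft => ?_,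
    fun f hf hif hsf => ⟨?_, fun s t hs ht hfs hft => ?_⟩, fun m c ht f g hf hg => ?_⟩
  · exact SplitForm.isConj_asymmetry_of_equivalent hf hg
  · obtain ⟨e, he⟩ := (SplitForm.isConj_asymmetry_iff hf hg).mp h
    obtain ⟨s, hs, hfs⟩ := hif.exists_admitsGram hF hf hsf
    obtain ⟨t, ht, hgt⟩ := hig.exists_admitsGram hF hg hsg
    exact SplitForm.equivalent_of_conj (SplitForm.isAsymmetry_asymmetry f hf)
      (SplitForm.isAsymmetry_asymmetry g hg) e he hs ht hfs hgt
  · obtain ⟨hf, h⟩ := hft.generatedBy ht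
    have hσ := SplitForm.isAsymmetry_asymmetry f hf
    have h := h _ hσ
    exact ⟨hf, h.indecomposable hF hσ hf, h.splits hσ, h.hasElementaryDivisors hσ⟩
  · exact hif.exists_admitsGram hF hf hsf
  · have hσ := SplitForm.isAsymmetry_asymmetry f hf
    exact SplitForm.NormalForm.eq_or_inv_of_conj hσ hσ (LinearEquiv.refl F V) (fun _ => rfl)
      hs ht hfs hft
  · exact (hf.typeG_inv ht).equivalent hg
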